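/- **Setting.** Let $\mathcal X\subset\mathbb R^{p}$, let $U$ be a probability distribution on $\mathcal X$, and let $x_1,x_2,\dots$ be i.i.d. from $U$, $X_n=(x_1,\dots,x_n)$. Let $C(\cdot,\cdot;\theta)$, $\theta\in\Theta$ ($\Theta\subset\mathbb R^q$, or any topological space), be measurable covariance (symmetric positive semidefinite) kernels on $\mathcal X$. Let $H$ be a probability distribution on $(0,\infty)$ and $\kappa:(0,\infty)\to(0,\infty)$ a measurable function with $\int \max\{0,-\log\kappa(r)\}\,dH(r)<\infty$ (for $\kappa(r)=1/r$ this holds whenever $\int r\,dH(r)<\infty$, e.g. for the Student-$t$, slash and contaminated-normal processes). Let $\phi>0$ be the error variance, $\mu$ the mean function, $t_1,\dots,t_n$ observation points (which may change with $n$), and let $\tau_0:\mathcal X\to\mathbb R$ be a fixed function. *True model:* given $\tau_0$ and $X_n$, $y_i=\mu(t_i)+\tau_0(x_i)+\varepsilon_i$ for $i\le n$, where $r\sim H$ and $(\varepsilon_1,\dots,\varepsilon_n)\mid r\sim N(0,\kappa(r)\phi I_n)$; its density is $$p(y_n\mid\tau_0,X_n)=\int N\big(y_n;\,\mu(t_\cdot)+\tau_0(x_\cdot),\,\kappa(r)\phi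 I_n\big)\,dH(r).$$ *Heavy-tailed process functional regression (HPFR) model with parameter $\theta$:* $y_i=\mu(t_i)+\tau(x_i)+\varepsilon_i$, where, given $r\sim H$, $\tau$ is a centred Gaussian process with covariance $\kappa(r)C(\cdot,\cdot;\theta)$, independent of $(\varepsilon_1,\dots,\varepsilon_n)\sim N(0,\kappa(r)\phi I_n)$; its marginal density is $$p_\theta(y_n\mid X_n)=\int\!\!\int N\big(y_n;\,\mu(t_\cdot)+\tau(x_\cdot),\,\kappa(r)\phi I_n\big)\,dP_{\theta}(\tau\mid r)\,dH(r).$$ Write $C_n=(C(x_i,x_j;\theta_0))_{i,j\le n}$ and $D[p_1,p_2]=\int(\log p_1-\log p_2)\,dp_1$ for the Kullback–Leibler divergence. **Theorem 1 (information consistency).** Let $\theta_0\in\Theta$ and let $\widehat\theta_n$ be a sequence of $\Theta$-valued random elements (the estimates of $\theta_0$). Assume: - (C1) $C(\cdot,\cdot;\theta)$ is continuous in $\theta$ for the supremum norm on $\mathcal X\times\mathcal X$, and $\widehat\theta_n\to\theta_0$ almost surely as $n\to\infty$; - (C2) $\tau_0$ lies in the reproducing kernel Hilbert space of $C(\cdot,\cdot;\theta_0)$,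 with finite norm; - (C3) $E_{X_n}\log|I_n+\phi^{-1}C_n|=o(n)$. Then, almost surely with respect to the randomness of $(\widehat\theta_n)$, $$\frac1n\,E_{X_n}\Big(D\big[p(y_n\mid\tau_0,X_n),\,p_{\widehat\theta_n}(y_n\mid X_n)\big]\Big)\to0\qquad(n\to\infty),$$ where $p_{\widehat\theta_n}$ is $p_\theta$ with the realized value of $\widehat\theta_n$ plugged in for $\theta$, and $E_{X_n}$ is the expectation over the distribution $U^{\otimes n}$ of $X_n$ only. -/

import Mathlib

open MeasureTheory ProbabilityTheory Filter Topology
open scoped ENNReal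

noncomputable section

namespace HPFR

variable {𝒳 : Type}

/-- `K` is a covariance kernel: symmetric, with all finite Gram matrices positive semidefinite. -/
def IsCovKernel (K : 𝒳 → 𝒳 → ℝ) : Prop :=
  (Matrix.of K).PosSemidef

/-- `f` belongs to the reproducing kernel Hilbert space of `K` and its RKHS norm is at most `B`. -/
def RKHSNormLE (K : 𝒳 → 𝒳 → ℝ) (f : 𝒳 → ℝ) (B : ℝ) : Prop :=
  ∃ (F : Type) (_ : NormedAddCommGroup F) (_ : InnerProductSpace ℝ F) (_ : CompleteSpace F)
    (_ : RKHS ℝ F 𝒳 ℝ),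
    (∀ x x' : 𝒳, RKHS.kernel F x x' 1 = K x x') ∧ ∃ g : F, ⇑g = f ∧ ‖g‖ ≤ B

/-- The covariance matrix `Cₙ = (K(xᵢ, xⱼ))ᵢⱼ` at the design points `X = (x₁, …, xₙ)`. -/
def gram (K : 𝒳 → 𝒳 → ℝ) {n : ℕ} (X : Fin n → 𝒳) : Matrix (Fin n) (Fin n) ℝ :=
  Matrix.of fun i j => K (X i) (X j)

/-- The density at `y` of `N(a, v Iₙ)`. -/
def isoGaussianDensity {n : ℕ} (a : Fin n → ℝ) (v : ℝ) (y : Fin n → ℝ) : ℝ≥0∞ :=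
  ∏ i, gaussianPDF (a i) v.toNNReal (y i)

/-- The density `p(yₙ | τ₀, Xₙ)` of the true model `yᵢ = mᵢ + τ₀(xᵢ) + εᵢ`, where
`ε | r ∼ N(0, κ(r) φ Iₙ)` and `r ∼ H`; here `mᵢ = μ(tᵢ)`. -/
def trueDensity (H : Measure ℝ) (κ : ℝ → ℝ) (φ : ℝ) (τ₀ : 𝒳 → ℝ) {n : ℕ} (m : Fin n → ℝ)
    (X : Fin n → 𝒳) (y : Fin n → ℝ) : ℝ≥0∞ :=
  ∫⁻ r, isoGaussianDensity (fun i => m i + τ₀ (X i)) (κ r * φ) y ∂H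

/-- The marginal density of `yₙ` given `Xₙ` under the heavy-tailed process model with kernel `K`:
`yᵢ = mᵢ + τ(xᵢ) + εᵢ`, where, given `r ∼ H`, the process `τ` and the error `ε` are independent,
`τ` is a centred Gaussian process with covariance `κ(r) K`, so that
`(τ(x₁), …, τ(xₙ)) | r ∼ N(0, κ(r) Cₙ)`, and `ε | r ∼ N(0, κ(r) φ Iₙ)`. -/
def modelDensity (H : Measure ℝ) (κ : ℝ → ℝ) (φ : ℝ) (K : 𝒳 → 𝒳 → ℝ) {n : ℕ} (m : Fin n → ℝ)
    (X : Fin n → 𝒳) (y : Fin n → ℝ) : ℝ≥0∞ :=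
  ∫⁻ r, ∫⁻ τ : EuclideanSpace ℝ (Fin n),
    isoGaussianDensity (fun i => m i + τ i) (κ r * φ) y
      ∂(multivariateGaussian 0 (κ r • gram K X)) ∂H

/-- The Kullback–Leibler divergence `D[p₁, p₂] = ∫ (log p₁ - log p₂) dp₁` of two densities on `ℝⁿ`
(with value `∞` when the integral is not defined). -/
def klDensity {n : ℕ} (p₁ p₂ : (Fin n → ℝ) → ℝ≥0∞) : ℝ≥0∞ :=
  InformationTheory.klDiv (volume.withDensity p₁) (volume.withDensity p₂)

/-- The expected regret `E_{Xₙ} log |Iₙ + φ⁻¹ Cₙ|`, for `x₁, …, xₙ` i.i.d. from `U`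
(the integrand is nonnegative). -/
def expectedRegret [MeasurableSpace 𝒳] (U : Measure 𝒳) (φ : ℝ) (K : 𝒳 → 𝒳 → ℝ) (n : ℕ) : ℝ≥0∞ :=
  ∫⁻ X : Fin n → 𝒳, ENNReal.ofReal (Real.log (1 + φ⁻¹ • gram K X).det) ∂(Measure.pi fun _ => U)

/-- `E_{Xₙ} D[p(yₙ | τ₀, Xₙ), p_K(yₙ | Xₙ)]`, for `x₁, …, xₙ` i.i.d. from `U`. -/
def expectedKL [MeasurableSpace 𝒳] (U : Measure 𝒳) (H : Measure ℝ) (κ : ℝ → ℝ) (φ : ℝ)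
    (τ₀ : 𝒳 → ℝ) (K : 𝒳 → 𝒳 → ℝ) {n : ℕ} (m : Fin n → ℝ) : ℝ≥0∞ :=
  ∫⁻ X : Fin n → 𝒳, klDensity (trueDensity H κ φ τ₀ m X) (modelDensity H κ φ K m X)
    ∂(Measure.pi fun _ => U)

end HPFR

end

/-! Fix a realization along which the estimates converge; the plugged-in kernels are then a
deterministic sequence `K n` converging uniformly to the true kernel `C`. Two estimates are needed.

Divergence at a fixed design. Rotating by an orthogonal eigenbasis of the Gram matrix turns both
laws into mixtures over `r` of product Gaussians, with variances `κ(r) φ` and `κ(r)(l i + φ)`.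
Matching components of equal `r` and using joint convexity of the divergence would produce a signal
term of order `fᵀ(K + φ)⁻¹f / κ(r)`, where `f` is the vector of values of `τ₀` at the design, but
`1/κ` need not be integrable. Components with `κ(r) < ε` are therefore matched with model components
whose scale lies in a fixed window `[a, b]` of positive `H`-mass. The signal term is then at most
`fᵀ(K + φ)⁻¹f / ε`, and the mismatch costs at most `n ∫_{κ < ε} (log b - log κ) dH`, which the
log-moment condition makes at most a small multiple of `n`. The RKHS condition and uniform closeness
`δ` of the kernels bound `fᵀ(K + φ)⁻¹f` by `B²(1 + nδ/φ)`. This is `klDensity_le`.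

Regret of `K n`. Comparing `n × n` determinants directly would cost about `n²δ/φ`, and no rate is
available for `δ`. Instead the design is cut into blocks of a fixed size `m`. A Fischer-type
inequality from concavity of `log det` bounds the regret of `K n` by the sum of the block regrets of
`C`, with error `m²δ/φ` per block, that is `mδ/φ` per observation. One first takes `m` large, then
`δ` small. This is `tendsto_expectedRegret_div`. -/

noncomputable section

namespace HPFR

/-! ### Determinant, trace and quadratic form inequalities -/

section LinearAlgebra

open Matrix

variable {ι : Type*} [Fintype ι] [DecidableEq ι]

/-- Real spectral theorem for a positive semidefinite matrix, with explicit orthogonal matrix. -/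
lemma exists_orthogonal_diagonalization {S : Matrix ι ι ℝ} (hS : S.PosSemidef) :
    ∃ (O : Matrix ι ι ℝ) (l : ι → ℝ), Oᵀ * O = 1 ∧ O * Oᵀ = 1 ∧ (∀ i, 0 ≤ l i) ∧
      S = O * diagonal l * Oᵀ := by
  refine ⟨hS.1.eigenvectorUnitary, hS.1.eigenvalues, ?_, ?_, hS.eigenvalues_nonneg, ?_⟩
  · have := Unitary.coe_star_mul_self hS.1.eigenvectorUnitary
    rwa [star_eq_conjTranspose, conjTranspose_eq_transpose_of_trivial] at this
  · have := Unitary.coe_mul_star_self hS.1.eigenvectorUnitary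
    rwa [Unitary.coe_star, star_eq_conjTranspose, conjTranspose_eq_transpose_of_trivial] at this
  · conv_lhs => rw [hS.1.spectral_theorem]
    rw [Unitary.conjStarAlgAut_apply, star_eq_conjTranspose,
      conjTranspose_eq_transpose_of_trivial]
    rfl

lemma log_det_le_trace_sub_card {W : Matrix ι ι ℝ} (hW : W.PosSemidef) (hdet : W.det ≠ 0) :
    Real.log W.det ≤ W.trace - Fintype.card ι := by
  have hdet' : W.det = ∏ i, hW.1.eigenvalues i := by simpa using hW.1.det_eq_prod_eigenvalues
  have htr : W.trace = ∑ i, hW.1.eigenvalues i := by simpa using hW.1.trace_eq_sum_eigenvalues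
  have hne : ∀ i, hW.1.eigenvalues i ≠ 0 := fun i h =>
    hdet (hdet'.trans (Finset.prod_eq_zero (Finset.mem_univ i) h))
  rw [hdet', htr, Real.log_prod fun i _ => hne i]
  calc ∑ i, Real.log (hW.1.eigenvalues i) ≤ ∑ i, (hW.1.eigenvalues i - 1) :=
        Finset.sum_le_sum fun i _ => Real.log_le_sub_one_of_pos
          (lt_of_le_of_ne (hW.eigenvalues_nonneg i) (hne i).symm)
    _ = _ := by simp [Finset.sum_sub_distrib]

/-- Concavity of `log det`, in the form of its tangent bound at `M⁻¹`. -/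
lemma log_det_add_log_det_le {A M : Matrix ι ι ℝ} (hA : A.PosDef) (hM : M.PosDef) :
    Real.log A.det + Real.log M.det ≤ (M * A).trace - Fintype.card ι := by
  obtain ⟨O, l, -, -, hl, hMl⟩ := exists_orthogonal_diagonalization hM.posSemidef
  -- With `M = R Rᵀ`, the matrix `Rᵀ A R` is symmetric and has the determinant and trace of `M A`,
  -- which need not be symmetric.
  set R : Matrix ι ι ℝ := O * diagonal (fun i => √(l i))
  have hR : M = R * Rᵀ := by
    have : diagonal (fun i => √(l i)) * diagonal (fun i => √(l i)) = diagonal l := by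
      rw [diagonal_mul_diagonal]; congr 1; ext i; exact Real.mul_self_sqrt (hl i)
    simp only [R, transpose_mul, diagonal_transpose]
    rw [hMl, ← this]; simp only [Matrix.mul_assoc]
  have hW : (Rᵀ * A * R).PosSemidef := by
    have := hA.posSemidef.conjTranspose_mul_mul_same R
    rwa [conjTranspose_eq_transpose_of_trivial] at this
  have hdet : (Rᵀ * A * R).det = A.det * M.det := by
    rw [hR]; simp only [det_mul, det_transpose]; ring
  have htr : (Rᵀ * A * R).trace = (M * A).trace := by
    rw [hR, trace_mul_comm, ← Matrix.mul_assoc]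
  have hpos := mul_pos hA.det_pos hM.det_pos
  rw [← Real.log_mul hA.det_pos.ne' hM.det_pos.ne', ← hdet, ← htr]
  exact log_det_le_trace_sub_card hW (by rw [hdet]; exact hpos.ne')

/-- The entries of `(1 + S)⁻¹` are bounded by one for positive semidefinite `S`. -/
lemma abs_inv_one_add_apply_le_one {S : Matrix ι ι ℝ} (hS : S.PosSemidef) (i j : ι) :
    |(1 + S)⁻¹ i j| ≤ 1 := by
  have hpd : (1 + S).PosDef := PosDef.one.add_posSemidef hS
  have hu : IsUnit (1 + S).det := isUnit_iff_ne_zero.2 hpd.det_pos.ne'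
  set w : ι → ℝ := fun k => (1 + S)⁻¹ k j
  have hw : (1 + S) *ᵥ w = Pi.single j 1 := by
    have : w = (1 + S)⁻¹ *ᵥ Pi.single j 1 := by rw [mulVec_single_one]; rfl
    rw [this, mulVec_mulVec, mul_nonsing_inv _ hu, one_mulVec]
  -- Since `w` is the `j`-th column of the inverse, `|w|² + wᵀSw = w j`. Hence `|w|² ≤ w j`, which
  -- forces `w j ≤ 1` and then `|w i| ≤ 1` for every `i`.
  have h1 : w ⬝ᵥ ((1 + S) *ᵥ w) = w j := by rw [hw]; simp
  have h2 : 0 ≤ w ⬝ᵥ (S *ᵥ w) := by simpa using hS.dotProduct_mulVec_nonneg w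
  rw [add_mulVec, one_mulVec, dotProduct_add] at h1
  have h3 : ∀ k, w k * w k ≤ w ⬝ᵥ w := fun k =>
    Finset.single_le_sum (f := fun k => w k * w k) (fun k _ => mul_self_nonneg _)
      (Finset.mem_univ k)
  have hj := h3 j
  have hi := h3 i
  change |w i| ≤ 1
  have hj1 : w j ≤ 1 := by nlinarith
  rw [abs_le]
  constructor <;> nlinarith

lemma trace_inv_one_add_mul_le {S T : Matrix ι ι ℝ} (hS : S.PosSemidef)
    {d : ℝ} (hd : ∀ i j, |T i j - S i j| ≤ d) :
    ((1 + S)⁻¹ * (1 + T)).trace ≤ Fintype.card ι + Fintype.card ι ^ 2 * d := by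
  have hu : IsUnit (1 + S).det :=
    isUnit_iff_ne_zero.2 (PosDef.one.add_posSemidef hS).det_pos.ne'
  have : 1 + T = (1 + S) + (T - S) := by abel
  rw [this, Matrix.mul_add, nonsing_inv_mul _ hu, trace_add, trace_one]
  gcongr
  simp only [trace, diag_apply, mul_apply, Matrix.sub_apply]
  calc ∑ i, ∑ j, (1 + S)⁻¹ i j * (T j i - S j i) ≤ ∑ _i : ι, ∑ _j : ι, d := by
        refine Finset.sum_le_sum fun i _ => Finset.sum_le_sum fun j _ => ?_
        calc (1 + S)⁻¹ i j * (T j i - S j i) ≤ |(1 + S)⁻¹ i j| * |T j i - S j i| := by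
              rw [← abs_mul]; exact le_abs_self _
          _ ≤ 1 * d := mul_le_mul (abs_inv_one_add_apply_le_one hS i j) (hd j i)
              (abs_nonneg _) zero_le_one
          _ = d := one_mul d
    _ = _ := by simp; ring

/-- Perturbed Fischer inequality for a two-block positive semidefinite matrix. -/
lemma log_det_one_add_fromBlocks_le {α β : Type*} [Fintype α] [Fintype β] [DecidableEq α]
    [DecidableEq β] {S : Matrix α α ℝ} {T : Matrix (α ⊕ β) (α ⊕ β) ℝ} (hS : S.PosSemidef)
    (hT : T.PosSemidef) {d : ℝ} (hd : ∀ i j, |T (.inl i) (.inl j) - S i j| ≤ d) :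
    Real.log (1 + T).det ≤ Real.log (1 + S).det + Fintype.card α ^ 2 * d +
      Real.log (1 + T.submatrix Sum.inr Sum.inr).det := by
  set T₁ := T.submatrix Sum.inl Sum.inl
  set T₂ := T.submatrix Sum.inr Sum.inr
  have hT₂ : T₂.PosSemidef := hT.submatrix _
  have pS : (1 + S).PosDef := PosDef.one.add_posSemidef hS
  have pT : (1 + T).PosDef := PosDef.one.add_posSemidef hT
  have pT₂ : (1 + T₂).PosDef := PosDef.one.add_posSemidef hT₂
  have hu : IsUnit (1 + T₂).det := isUnit_iff_ne_zero.2 pT₂.det_pos.ne'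
  -- The tangent to `log det` is taken at the block diagonal matrix with blocks `1 + S` and `1 +
  -- T₂`. The off-diagonal blocks of `T` drop out of the trace, the second block contributes exactly
  -- its size, and only the first sees the perturbation.
  set M : Matrix (α ⊕ β) (α ⊕ β) ℝ := fromBlocks (1 + S)⁻¹ 0 0 (1 + T₂)⁻¹
  have hM : M.PosDef := by
    refine PosDef.of_dotProduct_mulVec_pos ?_ fun x hx => ?_
    · simp only [M, IsHermitian, fromBlocks_conjTranspose, conjTranspose_zero]
      rw [pS.inv.1, pT₂.inv.1]
    · have e : x = Sum.elim (x ∘ Sum.inl) (x ∘ Sum.inr) := by simp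
      rw [e]
      simp only [M, fromBlocks_mulVec, star_trivial, zero_mulVec, add_zero, zero_add,
        sumElim_dotProduct_sumElim, Sum.elim_comp_inl, Sum.elim_comp_inr]
      have a1 : 0 ≤ (x ∘ Sum.inl) ⬝ᵥ ((1 + S)⁻¹ *ᵥ (x ∘ Sum.inl)) := by
        simpa using pS.inv.posSemidef.dotProduct_mulVec_nonneg (x ∘ Sum.inl)
      have a2 : 0 ≤ (x ∘ Sum.inr) ⬝ᵥ ((1 + T₂)⁻¹ *ᵥ (x ∘ Sum.inr)) := by
        simpa using pT₂.inv.posSemidef.dotProduct_mulVec_nonneg (x ∘ Sum.inr)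
      by_cases h1 : x ∘ Sum.inl = 0
      · have h2 : x ∘ Sum.inr ≠ 0 := by
          intro h2; apply hx; rw [e, h1, h2]; ext (_ | _) <;> rfl
        have := pT₂.inv.dotProduct_mulVec_pos h2
        simp only [star_trivial] at this
        linarith
      · have := pS.inv.dotProduct_mulVec_pos h1
        simp only [star_trivial] at this
        linarith
  have key := log_det_add_log_det_le pT hM
  have hblock : 1 + T = fromBlocks (1 + T₁) (T.submatrix Sum.inl Sum.inr)
      (T.submatrix Sum.inr Sum.inl) (1 + T₂) := by
    ext (i | i) (j | j) <;> simp [T₁, T₂, one_apply]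
  have htr : (M * (1 + T)).trace = ((1 + S)⁻¹ * (1 + T₁)).trace + Fintype.card β := by
    rw [hblock]
    rw [fromBlocks_multiply]
    simp only [Matrix.zero_mul, zero_add, add_zero, nonsing_inv_mul _ hu]
    simp [trace, Fintype.sum_sum_type]
  have hMdet : Real.log M.det = - Real.log (1 + S).det - Real.log (1 + T₂).det := by
    simp only [M, det_fromBlocks_zero₂₁, det_nonsing_inv, Ring.inverse_eq_inv']
    rw [Real.log_mul (inv_ne_zero pS.det_pos.ne') (inv_ne_zero pT₂.det_pos.ne'),
      Real.log_inv, Real.log_inv]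
    ring
  have hb := trace_inv_one_add_mul_le (T := T₁) hS hd
  rw [htr, hMdet, Fintype.card_sum] at key
  push_cast at key
  linarith

lemma det_one_add_smul_of_diagonalization {O : Matrix ι ι ℝ} {l : ι → ℝ} (hO : O * Oᵀ = 1)
    (c : ℝ) : (1 + c • (O * diagonal l * Oᵀ)).det = ∏ i, (1 + c * l i) := by
  have h : 1 + c • (O * diagonal l * Oᵀ) = O * diagonal (fun i => 1 + c * l i) * Oᵀ := by
    have : diagonal (fun i => 1 + c * l i) = 1 + c • diagonal l := by
      ext i j; by_cases hij : i = j <;> simp [hij]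
    rw [this, Matrix.mul_add, Matrix.add_mul, Matrix.mul_one, hO]
    simp
  have hd : O.det * O.det = 1 := by
    have := congrArg det hO
    rwa [det_mul, det_transpose, det_one] at this
  rw [h, det_mul, det_mul, det_transpose, det_diagonal]
  calc _ = (O.det * O.det) * ∏ i, (1 + c * l i) := by ring
    _ = _ := by rw [hd, one_mul]

lemma log_det_one_add_nonneg {S : Matrix ι ι ℝ} (hS : S.PosSemidef) {c : ℝ} (hc : 0 ≤ c) :
    0 ≤ Real.log (1 + c • S).det := by
  obtain ⟨O, l, -, hO, hl, rfl⟩ := exists_orthogonal_diagonalization hS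
  rw [det_one_add_smul_of_diagonalization hO]
  refine Real.log_nonneg ?_
  have := Finset.prod_le_prod (s := Finset.univ) (f := fun _ : ι => (1 : ℝ))
    (g := fun i => 1 + c * l i) (fun _ _ => zero_le_one)
    (fun i _ => le_add_of_nonneg_right (mul_nonneg hc (hl i)))
  simpa using this

/-- If `f fᵀ ≤ M (S + φ)` as quadratic forms then `fᵀ (S + φ)⁻¹ f ≤ M`, in eigencoordinates. -/
lemma sum_sq_div_le_of_quadratic_form_le {O : Matrix ι ι ℝ} {l : ι → ℝ} (hO : Oᵀ * O = 1)
    (hl : ∀ i, 0 ≤ l i) {φ M : ℝ} (hφ : 0 < φ) (hM : 0 ≤ M)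
    (f : ι → ℝ)
    (h : ∀ a : ι → ℝ, (a ⬝ᵥ f) ^ 2 ≤
      M * (a ⬝ᵥ ((O * diagonal l * Oᵀ) *ᵥ a) + φ * (a ⬝ᵥ a))) :
    ∑ i, (Oᵀ *ᵥ f) i ^ 2 / (l i + φ) ≤ M := by
  set c := Oᵀ *ᵥ f
  -- Eigencoordinates of the optimal test vector `(S + φ)⁻¹ f`. Both the pairing with `f` and the
  -- quadratic form then equal the sum `s` to be bounded, so the hypothesis reads `s² ≤ M s`.
  set b : ι → ℝ := fun i => c i / (l i + φ)
  have hb := h (O *ᵥ b)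
  have e0 : ∀ u v : ι → ℝ, (O *ᵥ u) ⬝ᵥ v = u ⬝ᵥ (Oᵀ *ᵥ v) := fun u v => by
    rw [dotProduct_mulVec, vecMul_transpose]
  have hp : ∀ i, 0 < l i + φ := fun i => by linarith [hl i]
  have e1 : (O *ᵥ b) ⬝ᵥ f = ∑ i, c i ^ 2 / (l i + φ) := by
    rw [e0]
    refine Finset.sum_congr rfl fun i _ => ?_
    simp only [b]; change c i / (l i + φ) * c i = _; ring
  have e2 : (O *ᵥ b) ⬝ᵥ ((O * diagonal l * Oᵀ) *ᵥ (O *ᵥ b)) + φ * ((O *ᵥ b) ⬝ᵥ (O *ᵥ b)) =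
      ∑ i, c i ^ 2 / (l i + φ) := by
    have e3 : Oᵀ *ᵥ ((O * diagonal l * Oᵀ) *ᵥ (O *ᵥ b)) = diagonal l *ᵥ b := by
      simp only [mulVec_mulVec]
      rw [show Oᵀ * (O * diagonal l * Oᵀ * O) = (Oᵀ * O) * diagonal l * (Oᵀ * O) by
        simp only [Matrix.mul_assoc], hO, Matrix.one_mul, Matrix.mul_one]
    rw [e0, e0, e3, mulVec_mulVec, hO, one_mulVec]
    simp only [dotProduct, mulVec_diagonal, Finset.mul_sum]
    rw [← Finset.sum_add_distrib]
    refine Finset.sum_congr rfl fun i _ => ?_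
    simp only [b]
    have := (hp i).ne'
    field_simp
  rw [e1, e2] at hb
  set s := ∑ i, c i ^ 2 / (l i + φ)
  have hs : 0 ≤ s := Finset.sum_nonneg fun i _ => div_nonneg (sq_nonneg _) (hp i).le
  rcases hs.eq_or_lt with h0 | h0
  · rwa [← h0]
  · nlinarith

end LinearAlgebra

/-! ### Kullback–Leibler divergence of densities and mixtures -/

section KL

open InformationTheory

variable {α : Type*} [MeasurableSpace α] {ν : Measure α}

lemma klDiv_withDensity_eq [SigmaFinite ν] {f g : α → ℝ≥0∞} (hf : Measurable f)
    (hg : Measurable g) (hfi : ∫⁻ x, f x ∂ν ≠ ∞) (hgi : ∫⁻ x, g x ∂ν ≠ ∞)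
    (hg0 : ∀ᵐ x ∂ν, g x ≠ 0) :
    klDiv (ν.withDensity f) (ν.withDensity g) =
      ∫⁻ x, g x * ENNReal.ofReal (klFun (f x / g x).toReal) ∂ν := by
  have hgt : ∀ᵐ x ∂ν, g x ≠ ∞ := (ae_lt_top hg hgi).mono fun _ h => h.ne
  have : IsFiniteMeasure (ν.withDensity g) := isFiniteMeasure_withDensity hgi
  have : IsFiniteMeasure (ν.withDensity f) := isFiniteMeasure_withDensity hfi
  have hfg : Measurable fun x => f x / g x := hf.div hg
  have e : ν.withDensity f = (ν.withDensity g).withDensity (fun x => f x / g x) := by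
    rw [← withDensity_mul _ hg hfg]
    refine withDensity_congr_ae ?_
    filter_upwards [hg0, hgt] with x h0 ht
    exact (ENNReal.mul_div_cancel h0 ht).symm
  have hac : ν.withDensity f ≪ ν.withDensity g := by
    rw [e]; exact withDensity_absolutelyContinuous _ _
  have hrn : (ν.withDensity f).rnDeriv (ν.withDensity g) =ᵐ[ν.withDensity g]
      fun x => f x / g x := by
    rw [e]; exact Measure.rnDeriv_withDensity _ hfg
  rw [klDiv_eq_lintegral_klFun_of_ac hac,
    lintegral_congr_ae (hrn.mono fun x hx => by rw [hx]),
    lintegral_withDensity_eq_lintegral_mul _ hg (by fun_prop)]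
  rfl

lemma mul_klFun_div {a b : ℝ} (hb : 0 < b) :
    b * klFun (a / b) = a * Real.log (a / b) + b - a := by
  rw [klFun_apply]; field_simp

/-- The function `(a, b) ↦ b klFun(a/b)` is convex and homogeneous of degree one; the left side is
its tangent plane along the ray `a = t b`. Integrating this bound with `t` the ratio of the
integrals gives Jensen's inequality. -/
lemma tangent_le_mul_klFun_div {a b t : ℝ} (ha : 0 < a) (hb : 0 < b) (ht : 0 < t) :
    a * Real.log t + b * (1 - t) ≤ b * klFun (a / b) := by
  rw [mul_klFun_div hb]
  have h := Real.log_le_sub_one_of_pos (x := t / (a / b)) (by positivity)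
  rw [Real.log_div ht.ne' (by positivity)] at h
  have h2 := mul_le_mul_of_nonneg_left h ha.le
  have : a * (t / (a / b) - 1) = b * t - a := by field_simp
  nlinarith

/-- Joint convexity of the Kullback–Leibler integrand under mixtures, at one point. -/
lemma mul_klFun_div_integral_le {R : Type*} [MeasurableSpace R] {H : Measure R} [NeZero H]
    {F G : R → ℝ} (hF : Measurable F) (hG : Measurable G) (hF0 : ∀ᵐ r ∂H, 0 < F r)
    (hG0 : ∀ᵐ r ∂H, 0 < G r) {f g : ℝ≥0∞} (hf : f = ∫⁻ r, ENNReal.ofReal (F r) ∂H)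
    (hg : ∫⁻ r, ENNReal.ofReal (G r) ∂H ≤ g) (hft : f ≠ ∞) (hgt : g ≠ ∞) :
    g * ENNReal.ofReal (klFun (f / g).toReal) ≤
      ∫⁻ r, ENNReal.ofReal (G r * klFun (F r / G r)) ∂H + g := by
  set D := ∫⁻ r, ENNReal.ofReal (G r * klFun (F r / G r)) ∂H
  by_cases hD : D = ∞
  · rw [hD, top_add]; exact le_top
  have hFi : Integrable F H := by
    refine (lintegral_ofReal_ne_top_iff_integrable hF.aestronglyMeasurable
      (hF0.mono fun _ h => h.le)).1 (hf ▸ hft)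
  have hGi : Integrable G H := by
    refine (lintegral_ofReal_ne_top_iff_integrable hG.aestronglyMeasurable
      (hG0.mono fun _ h => h.le)).1 (ne_top_of_le_ne_top hgt hg)
  have hK0 : ∀ᵐ r ∂H, 0 ≤ G r * klFun (F r / G r) := by
    filter_upwards [hF0, hG0] with r h1 h2
    exact mul_nonneg h2.le (klFun_nonneg (div_pos h1 h2).le)
  have hKm : Measurable fun r => G r * klFun (F r / G r) := by fun_prop
  have hKi : Integrable (fun r => G r * klFun (F r / G r)) H :=
    (lintegral_ofReal_ne_top_iff_integrable hKm.aestronglyMeasurable hK0).1 hD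
  have hDe : D = ENNReal.ofReal (∫ r, G r * klFun (F r / G r) ∂H) :=
    (ofReal_integral_eq_lintegral_ofReal hKi hK0).symm
  have pos : ∀ {K : R → ℝ}, Integrable K H → (∀ᵐ r ∂H, 0 < K r) → 0 < ∫ r, K r ∂H := by
    intro K hK hK0
    rw [integral_pos_iff_support_of_nonneg_ae (hK0.mono fun _ h => h.le) hK]
    have : Function.support K =ᵐ[H] Set.univ := by
      filter_upwards [hK0] with r hr
      exact propext ⟨fun _ => trivial, fun _ => hr.ne'⟩
    rw [measure_congr this]
    exact pos_iff_ne_zero.2 (Measure.measure_univ_ne_zero.2 (NeZero.ne H))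
  set a := ∫ r, F r ∂H
  set b := ∫ r, G r ∂H
  have ha : 0 < a := pos hFi hF0
  have hb : 0 < b := pos hGi hG0
  have hfa : f = ENNReal.ofReal a := by
    rw [hf]; exact (ofReal_integral_eq_lintegral_ofReal hFi (hF0.mono fun _ h => h.le)).symm
  have hgb : ENNReal.ofReal b ≤ g := by
    rw [ofReal_integral_eq_lintegral_ofReal hGi (hG0.mono fun _ h => h.le)]; exact hg
  have hbg : b ≤ g.toReal := by
    rw [← ENNReal.ofReal_le_iff_le_toReal hgt]; exact hgb
  set c := g.toReal
  have hc : 0 < c := hb.trans_le hbg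
  have hgc : g = ENNReal.ofReal c := (ENNReal.ofReal_toReal hgt).symm
  have main : b * klFun (a / b) ≤ ∫ r, G r * klFun (F r / G r) ∂H := by
    have ht : 0 < a / b := div_pos ha hb
    calc b * klFun (a / b) = a * Real.log (a / b) + b * (1 - a / b) := by
          rw [mul_klFun_div hb]; field_simp; ring
      _ = ∫ r, (F r * Real.log (a / b) + G r * (1 - a / b)) ∂H := by
          rw [integral_add (hFi.mul_const _) (hGi.mul_const _), integral_mul_const,
            integral_mul_const]
      _ ≤ _ := by
          refine integral_mono_ae ((hFi.mul_const _).add (hGi.mul_const _)) hKi ?_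
          filter_upwards [hF0, hG0] with r h1 h2
          exact tangent_le_mul_klFun_div h1 h2 ht
  -- Raising the second density from `b` to `c` lowers the logarithm and raises only the linear
  -- term. That loss is the `+ g` of the conclusion, and integrates to at most one.
  have step : c * klFun (a / c) ≤ b * klFun (a / b) + c := by
    rw [mul_klFun_div hc, mul_klFun_div hb]
    have : Real.log (a / c) ≤ Real.log (a / b) :=
      Real.log_le_log (div_pos ha hc) (div_le_div_of_nonneg_left ha.le hb hbg)
    nlinarith [mul_le_mul_of_nonneg_left this ha.le]
  rw [hDe, hfa, hgc, ← ENNReal.ofReal_div_of_pos hc, ENNReal.toReal_ofReal (div_pos ha hc).le,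
    ← ENNReal.ofReal_mul hc.le, ← ENNReal.ofReal_add _ hc.le]
  · exact ENNReal.ofReal_le_ofReal (by linarith)
  · exact le_trans (mul_nonneg hb.le (klFun_nonneg (div_pos ha hb).le)) main

/-- Kullback–Leibler divergence of a mixture `∫ F dH` from a density dominating `∫ G dH`. -/
lemma klDiv_mixture_le [SigmaFinite ν] {R : Type*} [MeasurableSpace R] {H : Measure R}
    [SFinite H] [NeZero H] {F G : R → α → ℝ} (hF : Measurable (Function.uncurry F))
    (hG : Measurable (Function.uncurry G)) (hF0 : ∀ᵐ r ∂H, ∀ x, 0 < F r x)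
    (hG0 : ∀ᵐ r ∂H, ∀ x, 0 < G r x) {f g : α → ℝ≥0∞}
    (hfF : ∀ x, f x = ∫⁻ r, ENNReal.ofReal (F r x) ∂H) (hg : Measurable g)
    (hGg : ∀ x, ∫⁻ r, ENNReal.ofReal (G r x) ∂H ≤ g x)
    (hfi : ∫⁻ x, f x ∂ν ≠ ∞) (hgi : ∫⁻ x, g x ∂ν ≤ 1) :
    klDiv (ν.withDensity f) (ν.withDensity g) ≤
      ∫⁻ r, ∫⁻ x, ENNReal.ofReal (G r x * klFun (F r x / G r x)) ∂ν ∂H + 1 := by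
  have hf : Measurable f := by
    have : f = fun x => ∫⁻ r, ENNReal.ofReal (F r x) ∂H := funext hfF
    rw [this]
    exact Measurable.lintegral_prod_left' (f := fun p : R × α => ENNReal.ofReal (F p.1 p.2))
      hF.ennreal_ofReal
  have hgi' : ∫⁻ x, g x ∂ν ≠ ∞ := ne_top_of_le_ne_top ENNReal.one_ne_top hgi
  have hFx : ∀ x, Measurable fun r => F r x := fun x => hF.comp measurable_prodMk_right
  have hGx : ∀ x, Measurable fun r => G r x := fun x => hG.comp measurable_prodMk_right
  have hg0 : ∀ x, g x ≠ 0 := by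
    intro x h0
    have h1 : ∫⁻ r, ENNReal.ofReal (G r x) ∂H = 0 := le_antisymm (h0 ▸ hGg x) bot_le
    rw [lintegral_eq_zero_iff (hGx x).ennreal_ofReal] at h1
    have : ∀ᵐ r ∂H, False := by
      filter_upwards [h1, hG0] with r h2 h3
      exact absurd (ENNReal.ofReal_eq_zero.1 h2) (not_le.2 (h3 x))
    rw [ae_iff] at this
    simp [NeZero.ne] at this
  rw [klDiv_withDensity_eq hf hg hfi hgi' (.of_forall hg0)]
  have hKm : Measurable fun p : R × α =>
      ENNReal.ofReal (G p.1 p.2 * klFun (F p.1 p.2 / G p.1 p.2)) :=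
    (hG.mul (measurable_klFun.comp (hF.div hG))).ennreal_ofReal
  calc _ ≤ ∫⁻ x, (∫⁻ r, ENNReal.ofReal (G r x * klFun (F r x / G r x)) ∂H + g x) ∂ν := by
        refine lintegral_mono_ae ?_
        filter_upwards [ae_lt_top hf hfi, ae_lt_top hg hgi'] with x h1 h2
        exact mul_klFun_div_integral_le (hFx x) (hGx x) (hF0.mono fun _ h => h x)
          (hG0.mono fun _ h => h x) (hfF x) (hGg x) h1.ne h2.ne
    _ = ∫⁻ x, ∫⁻ r, ENNReal.ofReal (G r x * klFun (F r x / G r x)) ∂H ∂ν + ∫⁻ x, g x ∂ν :=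
        lintegral_add_right _ hg
    _ ≤ _ := by
        gcongr
        rw [lintegral_lintegral_swap]
        exact (hKm.comp measurable_swap).aemeasurable

end KL

/-! ### Product Gaussians and their divergence -/

section Gaussian

open InformationTheory
open scoped NNReal

lemma lintegral_fin_prod_eq_prod {n : ℕ} {E : Type*} [MeasurableSpace E]
    {μ : Fin n → Measure E} [∀ i, SigmaFinite (μ i)] {f : Fin n → E → ℝ≥0∞}
    (hf : ∀ i, Measurable (f i)) :
    ∫⁻ x : Fin n → E, ∏ i, f i (x i) ∂(Measure.pi μ) = ∏ i, ∫⁻ x, f i x ∂(μ i) := by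
  induction n with
  | zero => simp
  | succ n ih =>
    rw [← ((measurePreserving_piFinSuccAbove (α := fun _ => E) μ 0).symm).lintegral_comp_emb
      (MeasurableEquiv.measurableEmbedding _)]
    simp_rw [MeasurableEquiv.piFinSuccAbove_symm_apply, Fin.insertNthEquiv,
      Fin.prod_univ_succ, Fin.insertNth_zero, Equiv.coe_fn_mk, Fin.cons_succ,
      Fin.zero_succAbove, cast_eq, Fin.cons_zero]
    have hm : Measurable fun y : Fin n → E => ∏ i, f i.succ (y i) :=
      Finset.measurable_prod _ fun i _ => (hf i.succ).comp (measurable_pi_apply i)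
    rw [← ih fun i => hf i.succ]
    exact lintegral_prod_mul (hf 0).aemeasurable hm.aemeasurable

lemma withDensity_prod_gaussianPDF {n : ℕ} (c : Fin n → ℝ) {v : Fin n → ℝ≥0} (hv : ∀ i, v i ≠ 0) :
    (volume : Measure (Fin n → ℝ)).withDensity (fun u => ∏ i, gaussianPDF (c i) (v i) (u i)) =
      Measure.pi fun i => gaussianReal (c i) (v i) := by
  symm
  refine Measure.pi_eq fun s hs => ?_
  rw [withDensity_apply _ (MeasurableSet.univ_pi hs), volume_pi, Measure.restrict_pi_pi,
    lintegral_fin_prod_eq_prod fun i => measurable_gaussianPDF _ _]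
  refine Finset.prod_congr rfl fun i _ => ?_
  rw [gaussianReal_apply _ (hv i)]

/-- Completing the square in `w`: prior times likelihood equals marginal times posterior. -/
lemma gaussianPDFReal_mul_gaussianPDFReal {v₁ v₂ : ℝ≥0} (h₁ : v₁ ≠ 0) (h₂ : v₂ ≠ 0) (u w : ℝ) :
    gaussianPDFReal 0 v₂ w * gaussianPDFReal w v₁ u =
      gaussianPDFReal 0 (v₁ + v₂) u *
        gaussianPDFReal (v₂ * u / (v₁ + v₂)) (v₁ * v₂ / (v₁ + v₂)) w := by
  have p₁ : (0 : ℝ) < v₁ := by positivity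
  have p₂ : (0 : ℝ) < v₂ := by positivity
  simp only [gaussianPDFReal, NNReal.coe_add, NNReal.coe_div, NNReal.coe_mul]
  rw [mul_mul_mul_comm, mul_mul_mul_comm (√(2 * Real.pi * (v₁ + v₂)))⁻¹, ← Real.exp_add,
    ← Real.exp_add, ← mul_inv, ← mul_inv, ← Real.sqrt_mul (by positivity),
    ← Real.sqrt_mul (by positivity)]
  congr 1
  · congr 2; field_simp
  · congr 1; field_simp; ring

/-- Zero variance `v₂` has to be allowed, because Gram matrices may be singular; the Gaussian is
then a point mass. -/
lemma lintegral_gaussianPDF_gaussianReal {v₁ : ℝ≥0} (h₁ : v₁ ≠ 0) (v₂ : ℝ≥0) (u : ℝ) :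
    ∫⁻ w, gaussianPDF w v₁ u ∂(gaussianReal 0 v₂) = gaussianPDF 0 (v₁ + v₂) u := by
  have hm : Measurable fun w => gaussianPDF w v₁ u :=
    measurable_uncurry_gaussianPDF.comp
      (measurable_id.prodMk (measurable_const (a := (v₁, u))))
  by_cases h₂ : v₂ = 0
  · subst h₂
    rw [gaussianReal_zero_var, lintegral_dirac' _ hm, add_zero]
  · rw [gaussianReal_of_var_ne_zero _ h₂,
      lintegral_withDensity_eq_lintegral_mul _ (measurable_gaussianPDF _ _) hm]
    have e : ∀ w, (gaussianPDF 0 v₂ * fun w => gaussianPDF w v₁ u) w =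
        gaussianPDF 0 (v₁ + v₂) u *
          gaussianPDF (v₂ * u / (v₁ + v₂)) (v₁ * v₂ / (v₁ + v₂)) w := fun w => by
      simp only [Pi.mul_apply, gaussianPDF]
      rw [← ENNReal.ofReal_mul (gaussianPDFReal_nonneg _ _ _),
        ← ENNReal.ofReal_mul (gaussianPDFReal_nonneg _ _ _),
        gaussianPDFReal_mul_gaussianPDFReal h₁ h₂]
    simp_rw [e]
    rw [lintegral_const_mul _ (measurable_gaussianPDF _ _), lintegral_gaussianPDF_eq_one, mul_one]
    positivity

lemma log_gaussianPDFReal (m : ℝ) {v : ℝ≥0} (hv : v ≠ 0) (x : ℝ) :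
    Real.log (gaussianPDFReal m v x) =
      -(Real.log (2 * Real.pi * v) / 2) - (x - m) ^ 2 / (2 * v) := by
  have p : (0 : ℝ) < v := by positivity
  rw [gaussianPDFReal, Real.log_mul (by positivity) (Real.exp_pos _).ne', Real.log_exp,
    Real.log_inv, Real.log_sqrt (by positivity)]
  ring

lemma integral_sub_sq_gaussianReal (c : ℝ) (v : ℝ≥0) (m : ℝ) :
    Integrable (fun x => (x - m) ^ 2) (gaussianReal c v) ∧
      ∫ x, (x - m) ^ 2 ∂(gaussianReal c v) = v + (c - m) ^ 2 := by
  have h2 : MemLp (fun x : ℝ => x - m) 2 (gaussianReal c v) :=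
    (memLp_id_gaussianReal 2).sub (memLp_const m)
  refine ⟨h2.integrable_sq, ?_⟩
  have hv := variance_eq_sub h2
  have h3 : Var[fun x : ℝ => x - m; gaussianReal c v] = v := by
    rw [variance_sub_const (by fun_prop)]; exact variance_fun_id_gaussianReal
  have h4 : ∫ x, (x - m) ∂(gaussianReal c v) = c - m := by
    have : Integrable (fun x : ℝ => x) (gaussianReal c v) :=
      (memLp_id_gaussianReal 1).integrable le_rfl
    rw [integral_sub this (integrable_const _)]
    simp [integral_id_gaussianReal]
  rw [h3, h4] at hv
  simp only [Pi.pow_apply] at hv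
  linarith

/-- Explicit value of the Kullback–Leibler divergence of a product of Gaussians from a rescaled
product of centred Gaussians, as an upper bound. -/
lemma lintegral_klFun_gaussian_le {n : ℕ} (c : Fin n → ℝ) {v₀ : ℝ≥0} (h₀ : v₀ ≠ 0)
    {v : Fin n → ℝ≥0} (hv : ∀ i, v i ≠ 0) {θ : ℝ} (hθ : 0 < θ) (hθ1 : θ ≤ 1) :
    ∫⁻ u : Fin n → ℝ, ENNReal.ofReal ((θ * ∏ i, gaussianPDFReal 0 (v i) (u i)) *
      klFun ((∏ i, gaussianPDFReal (c i) v₀ (u i)) / (θ * ∏ i, gaussianPDFReal 0 (v i) (u i)))) ≤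
    ENNReal.ofReal (∑ i, (Real.log (v i / v₀) + (v₀ + c i ^ 2) / v i - 1) / 2 - Real.log θ) := by
  set F : (Fin n → ℝ) → ℝ := fun u => ∏ i, gaussianPDFReal (c i) v₀ (u i)
  set G : (Fin n → ℝ) → ℝ := fun u => ∏ i, gaussianPDFReal 0 (v i) (u i)
  have hF0 : ∀ u, 0 < F u := fun u => Finset.prod_pos fun i _ => gaussianPDFReal_pos _ _ _ h₀
  have hG0 : ∀ u, 0 < G u := fun u => Finset.prod_pos fun i _ => gaussianPDFReal_pos _ _ _ (hv i)
  have hFm : Measurable F := Finset.measurable_prod _ fun i _ =>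
    (measurable_gaussianPDFReal _ _).comp (measurable_pi_apply i)
  have hFi : Integrable F := Integrable.fintype_prod fun i => integrable_gaussianPDFReal _ _
  have hGi : Integrable G := Integrable.fintype_prod fun i => integrable_gaussianPDFReal _ _
  have hF1 : ∫ u, F u = 1 := by
    simp only [F]
    rw [integral_fintype_prod_volume_eq_prod]
    simp [integral_gaussianPDFReal_eq_one _ h₀]
  have hG1 : ∫ u, G u = 1 := by
    simp only [G]
    rw [integral_fintype_prod_volume_eq_prod]
    simp [integral_gaussianPDFReal_eq_one _ (hv _)]
  set q : Fin n → ℝ → ℝ := fun i x =>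
    Real.log (v i / v₀) / 2 + ((x - 0) ^ 2 / (2 * v i) - (x - c i) ^ 2 / (2 * v₀))
  have hlog : ∀ u, Real.log (F u / (θ * G u)) = ∑ i, q i (u i) - Real.log θ := by
    intro u
    rw [Real.log_div (hF0 u).ne' (mul_pos hθ (hG0 u)).ne', Real.log_mul hθ.ne' (hG0 u).ne',
      Real.log_prod fun i _ => (gaussianPDFReal_pos _ _ _ h₀).ne',
      Real.log_prod fun i _ => (gaussianPDFReal_pos _ _ _ (hv i)).ne', ← sub_sub, sub_right_comm,
      ← Finset.sum_sub_distrib]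
    congr 1
    refine Finset.sum_congr rfl fun i _ => ?_
    have p₀ : (v₀ : ℝ) ≠ 0 := by positivity
    have p : (v i : ℝ) ≠ 0 := by have := hv i; positivity
    rw [log_gaussianPDFReal _ h₀, log_gaussianPDFReal _ (hv i),
      Real.log_mul (by positivity) p₀, Real.log_mul (by positivity) p]
    simp only [q]
    rw [Real.log_div p p₀]
    ring
  set P : Measure (Fin n → ℝ) := Measure.pi fun i => gaussianReal (c i) v₀
  have hP : P = volume.withDensity fun u => ENNReal.ofReal (F u) := by
    simp only [P]
    rw [← withDensity_prod_gaussianPDF c (v := fun _ => v₀) fun _ => h₀]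
    congr 1; ext u
    rw [ENNReal.ofReal_prod_of_nonneg fun i _ => gaussianPDFReal_nonneg _ _ _]; rfl
  have hq : ∀ i, Integrable (q i) (gaussianReal (c i) v₀) ∧
      ∫ x, q i x ∂(gaussianReal (c i) v₀) =
        (Real.log (v i / v₀) + (v₀ + c i ^ 2) / v i - 1) / 2 := by
    intro i
    have i1 := integral_sub_sq_gaussianReal (c i) v₀ 0
    have i2 := integral_sub_sq_gaussianReal (c i) v₀ (c i)
    refine ⟨(integrable_const _).add ((i1.1.div_const _).sub (i2.1.div_const _)), ?_⟩
    simp only [q]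
    have i3 : Integrable (fun x => (x - 0) ^ 2 / (2 * v i) - (x - c i) ^ 2 / (2 * v₀))
      (gaussianReal (c i) v₀) := (i1.1.div_const _).sub (i2.1.div_const _)
    rw [integral_add (integrable_const _) i3,
      integral_sub (i1.1.div_const _) (i2.1.div_const _), integral_div (2 * (v i : ℝ)),
      integral_div (2 * (v₀ : ℝ)), i1.2, i2.2]
    have p₀ : (v₀ : ℝ) ≠ 0 := by positivity
    have p : (v i : ℝ) ≠ 0 := by have := hv i; positivity
    simp
    field_simp
    ring
  have hqi : ∀ i, Integrable (fun u : Fin n → ℝ => q i (u i)) P := fun i =>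
    integrable_comp_eval (hq i).1
  have hh : Integrable (fun u : Fin n → ℝ => ∑ i, q i (u i) - Real.log θ) P :=
    (integrable_finsetSum _ fun i _ => hqi i).sub (integrable_const _)
  have hhI : ∫ u, (∑ i, q i (u i) - Real.log θ) ∂P =
      ∑ i, (Real.log (v i / v₀) + (v₀ + c i ^ 2) / v i - 1) / 2 - Real.log θ := by
    rw [integral_sub (integrable_finsetSum _ fun i _ => hqi i) (integrable_const _),
      integral_finsetSum _ fun i _ => hqi i]
    simp only [integral_const, probReal_univ, one_smul]
    congr 1
    refine Finset.sum_congr rfl fun i _ => ?_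
    rw [← (hq i).2]
    exact integral_comp_eval (hq i).1.aestronglyMeasurable
  have hFh : Integrable (fun u => F u * (∑ i, q i (u i) - Real.log θ)) := by
    rw [hP, integrable_withDensity_iff_integrable_smul' hFm.ennreal_ofReal (by simp)] at hh
    refine hh.congr (.of_forall fun u => ?_)
    simp [ENNReal.toReal_ofReal (hF0 u).le]
  have hFhI : ∫ u, F u * (∑ i, q i (u i) - Real.log θ) =
      ∑ i, (Real.log (v i / v₀) + (v₀ + c i ^ 2) / v i - 1) / 2 - Real.log θ := by
    rw [← hhI, hP, integral_withDensity_eq_integral_toReal_smul hFm.ennreal_ofReal (by simp)]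
    refine integral_congr_ae (.of_forall fun u => ?_)
    simp [ENNReal.toReal_ofReal (hF0 u).le]
  have hK : ∀ u, θ * G u * klFun (F u / (θ * G u)) =
      F u * (∑ i, q i (u i) - Real.log θ) + θ * G u - F u := fun u => by
    rw [mul_klFun_div (mul_pos hθ (hG0 u)), hlog]
  change ∫⁻ u, ENNReal.ofReal (θ * G u * klFun (F u / (θ * G u))) ≤ _
  rw [← ofReal_integral_eq_lintegral_ofReal]
  · refine ENNReal.ofReal_le_ofReal ?_
    simp_rw [hK]
    have hsum : Integrable fun u => F u * (∑ i, q i (u i) - Real.log θ) + θ * G u :=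
      hFh.add (hGi.const_mul θ)
    -- The masses of `θ G` and `F` leave the extra term `θ - 1`, which is dropped because `θ ≤ 1`.
    rw [integral_sub hsum hFi, integral_add hFh (hGi.const_mul θ),
      hFhI, integral_const_mul, hF1, hG1]
    linarith
  · simp_rw [hK]
    exact (hFh.add (hGi.const_mul θ)).sub hFi
  · refine .of_forall fun u => mul_nonneg (mul_pos hθ (hG0 u)).le (klFun_nonneg ?_)
    exact (div_pos (hF0 u) (mul_pos hθ (hG0 u))).le

end Gaussian

/-! ### Reduction to eigencoordinates and comparison of scale mixtures -/

variable {𝒳 : Type}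

open InformationTheory Matrix
open scoped NNReal

lemma sum_sq_sub_orthogonal_mulVec {ι : Type*} [Fintype ι] [DecidableEq ι] {O : Matrix ι ι ℝ}
    (hO : Oᵀ * O = 1) (hO' : O * Oᵀ = 1) (u a : ι → ℝ) :
    ∑ i, ((O *ᵥ u) i - a i) ^ 2 = ∑ i, (u i - (Oᵀ *ᵥ a) i) ^ 2 := by
  have h : O *ᵥ u - a = O *ᵥ (u - Oᵀ *ᵥ a) := by
    rw [mulVec_sub, mulVec_mulVec, hO', one_mulVec]
  have e : ∀ w : ι → ℝ, ∑ i, w i ^ 2 = w ⬝ᵥ w := fun w =>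
    Finset.sum_congr rfl fun i _ => sq (w i)
  have e1 := e (O *ᵥ u - a)
  have e2 := e (u - Oᵀ *ᵥ a)
  simp only [Pi.sub_apply] at e1 e2
  rw [e1, e2, h, dotProduct_mulVec, vecMul_mulVec, ← mulVec_transpose, transpose_mul,
    transpose_transpose, hO, one_mulVec]

lemma prod_gaussianPDFReal {n : ℕ} (c : Fin n → ℝ) (v : ℝ≥0) (u : Fin n → ℝ) :
    ∏ i, gaussianPDFReal (c i) v (u i) =
      (√(2 * Real.pi * v))⁻¹ ^ n * Real.exp (-(∑ i, (u i - c i) ^ 2) / (2 * v)) := by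
  simp only [gaussianPDFReal, Finset.prod_mul_distrib, Finset.prod_const, Finset.card_univ,
    Fintype.card_fin, ← Real.exp_sum, neg_div, Finset.sum_neg_distrib, Finset.sum_div]

lemma prod_gaussianPDF_eq_ofReal {n : ℕ} (c : Fin n → ℝ) (v : Fin n → ℝ≥0) (u : Fin n → ℝ) :
    ∏ i, gaussianPDF (c i) (v i) (u i) =
      ENNReal.ofReal (∏ i, gaussianPDFReal (c i) (v i) (u i)) := by
  rw [ENNReal.ofReal_prod_of_nonneg fun i _ => gaussianPDFReal_nonneg _ _ _]; rfl

/-- An isotropic density depends only on the distance to its mean, so a rotation of the argument can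
be moved onto the mean. -/
lemma isoGaussianDensity_orthogonal {n : ℕ} {O : Matrix (Fin n) (Fin n) ℝ}
    (hO : Oᵀ * O = 1) (hO' : O * Oᵀ = 1) (m a u : Fin n → ℝ) (v : ℝ) :
    isoGaussianDensity (fun i => m i + a i) v (fun i => m i + (O *ᵥ u) i) =
      ∏ i, gaussianPDF ((Oᵀ *ᵥ a) i) v.toNNReal (u i) := by
  rw [isoGaussianDensity, prod_gaussianPDF_eq_ofReal, prod_gaussianPDF_eq_ofReal,
    prod_gaussianPDFReal, prod_gaussianPDFReal, ← sum_sq_sub_orthogonal_mulVec hO hO']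
  simp

/-- Characteristic functions are compared, which covers degenerate covariances having no density. -/
lemma multivariateGaussian_eq_map_pi {n : ℕ} {O : Matrix (Fin n) (Fin n) ℝ} {l : Fin n → ℝ}
    (hl : ∀ i, 0 ≤ l i) (hS : (O * diagonal l * Oᵀ).PosSemidef) :
    multivariateGaussian 0 (O * diagonal l * Oᵀ) =
      (Measure.pi fun i => gaussianReal 0 (l i).toNNReal).map
        (fun w => WithLp.toLp 2 (O *ᵥ w)) := by
  have hm : Measurable fun w : Fin n → ℝ => WithLp.toLp 2 (O *ᵥ w) := by fun_prop
  have : IsProbabilityMeasure ((Measure.pi fun i => gaussianReal 0 (l i).toNNReal).map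
      (fun w => WithLp.toLp 2 (O *ᵥ w))) := Measure.isProbabilityMeasure_map hm.aemeasurable
  refine Measure.ext_of_charFun (funext fun t => ?_)
  have hm2 : Measurable fun w : Fin n → ℝ => WithLp.toLp 2 w := by fun_prop
  have e : charFun ((Measure.pi fun i => gaussianReal 0 (l i).toNNReal).map
      (fun w => WithLp.toLp 2 (O *ᵥ w))) t =
      charFun ((Measure.pi fun i => gaussianReal 0 (l i).toNNReal).map (WithLp.toLp 2))
        (WithLp.toLp 2 (Oᵀ *ᵥ t.ofLp)) := by
    rw [charFun_apply, charFun_apply, integral_map hm.aemeasurable (by fun_prop),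
      integral_map hm2.aemeasurable (by fun_prop)]
    refine integral_congr_ae (.of_forall fun w => ?_)
    simp only [EuclideanSpace.inner_eq_star_dotProduct, star_trivial]
    rw [dotProduct_mulVec, ← mulVec_transpose]
  rw [e, charFun_multivariateGaussian hS, charFun_pi]
  simp_rw [charFun_gaussianReal]
  rw [← Complex.exp_sum]
  congr 1
  have e3 : t.ofLp ⬝ᵥ (O * diagonal l * Oᵀ) *ᵥ t.ofLp =
      ∑ i, l i * (Oᵀ *ᵥ t.ofLp) i ^ 2 := by
    rw [← mulVec_mulVec, ← mulVec_mulVec, dotProduct_mulVec, ← mulVec_transpose]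
    refine Finset.sum_congr rfl fun i _ => ?_
    rw [mulVec_diagonal]; ring
  simp only [inner_zero_right, Complex.ofReal_zero, zero_mul, zero_sub, mul_zero]
  rw [e3]
  push_cast
  rw [Finset.sum_div, ← Finset.sum_neg_distrib]
  refine Finset.sum_congr rfl fun i _ => ?_
  rw [Real.coe_toNNReal _ (hl i)]

/-- After rotation the coordinates separate, and each is the convolution of `N(0, s l i)` with `N(0,
sφ)`. -/
lemma lintegral_isoGaussianDensity_multivariateGaussian {n : ℕ} {O : Matrix (Fin n) (Fin n) ℝ}
    {l : Fin n → ℝ} (hO : Oᵀ * O = 1) (hO' : O * Oᵀ = 1) (hl : ∀ i, 0 ≤ l i) {s φ : ℝ}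
    (hs : 0 < s) (hφ : 0 < φ) (hS : (O * diagonal l * Oᵀ).PosSemidef) (m u : Fin n → ℝ) :
    ∫⁻ τ : EuclideanSpace ℝ (Fin n), isoGaussianDensity (fun i => m i + τ i) (s * φ)
        (fun i => m i + (O *ᵥ u) i) ∂(multivariateGaussian 0 (s • (O * diagonal l * Oᵀ))) =
      ∏ i, gaussianPDF 0 (s * (l i + φ)).toNNReal (u i) := by
  have hsS : s • (O * diagonal l * Oᵀ) = O * diagonal (s • l) * Oᵀ := by
    rw [diagonal_smul]; simp
  have hsl : ∀ i, 0 ≤ (s • l) i := fun i => mul_nonneg hs.le (hl i)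
  have hv : (s * φ).toNNReal ≠ 0 := by
    rw [Ne, Real.toNNReal_eq_zero, not_le]; positivity
  have hpdf : ∀ (x : ℝ) (v : ℝ≥0), Measurable fun w => gaussianPDF w v x := fun x v =>
    measurable_uncurry_gaussianPDF.comp (measurable_id.prodMk (measurable_const (a := (v, x))))
  have hiso : Measurable fun τ : EuclideanSpace ℝ (Fin n) =>
      isoGaussianDensity (fun i => m i + τ i) (s * φ) (fun i => m i + (O *ᵥ u) i) := by
    refine Finset.measurable_prod _ fun i _ => (hpdf _ _).comp ?_
    fun_prop
  rw [hsS, multivariateGaussian_eq_map_pi hsl (hsS ▸ hS.smul hs.le),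
    lintegral_map hiso (by fun_prop)]
  simp only [isoGaussianDensity_orthogonal hO hO', mulVec_mulVec, hO, one_mulVec]
  rw [lintegral_fin_prod_eq_prod (f := fun i w => gaussianPDF w (s * φ).toNNReal (u i))
    fun i => hpdf _ _]
  refine Finset.prod_congr rfl fun i _ => ?_
  rw [lintegral_gaussianPDF_gaussianReal hv, ← Real.toNNReal_add (by positivity) (hsl i)]
  congr 2
  simp only [Pi.smul_apply, smul_eq_mul]; ring

lemma measurePreserving_add_orthogonal_mulVec {n : ℕ} {O : Matrix (Fin n) (Fin n) ℝ}
    (hO : Oᵀ * O = 1) (m : Fin n → ℝ) :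
    MeasurePreserving (fun (u : Fin n → ℝ) i => m i + (O *ᵥ u) i) := by
  have hd : O.det * O.det = 1 := by
    have := congrArg det hO
    rwa [det_mul, det_transpose, det_one] at this
  have hdet : |O.det⁻¹| = 1 := by
    rw [abs_inv, inv_eq_one]
    nlinarith [abs_nonneg O.det, abs_mul_abs_self O.det]
  have h1 : MeasurePreserving (fun u : Fin n → ℝ => O *ᵥ u) := by
    refine ⟨by fun_prop, ?_⟩
    have := Real.map_matrix_volume_pi_eq_smul_volume_pi (M := O) (fun h => by simp [h] at hd)
    rw [hdet] at this
    have e : (fun u : Fin n → ℝ => O *ᵥ u) = toLin' O := by ext; simp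
    rw [e, this]
    simp
  exact (measurePreserving_add_left volume m).comp h1

/-- The densities on the left are those of the images under `T`, so this is the data processing
inequality. Only this direction is needed. -/
lemma klDiv_withDensity_comp_le {α : Type*} [MeasurableSpace α] {ν : Measure α} {T S : α → α}
    (hT : MeasurePreserving T ν ν) (hS : Measurable S) (hST : ∀ x, S (T x) = x)
    {f g : α → ℝ≥0∞} (hf : Measurable f) (hg : Measurable g) (hfi : ∫⁻ x, f x ∂ν ≠ ∞)
    (hgi : ∫⁻ x, g x ∂ν ≠ ∞) :
    klDiv (ν.withDensity (f ∘ S)) (ν.withDensity (g ∘ S)) ≤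
      klDiv (ν.withDensity f) (ν.withDensity g) := by
  have key : ∀ {h : α → ℝ≥0∞}, Measurable h →
      (ν.withDensity h).map T = ν.withDensity (h ∘ S) := by
    intro h hh
    ext s hs
    rw [Measure.map_apply hT.measurable hs, withDensity_apply _ hs,
      withDensity_apply _ (hT.measurable hs),
      ← hT.setLIntegral_comp_preimage hs (hh.comp hS)]
    simp [hST]
  have : IsFiniteMeasure (ν.withDensity g) := isFiniteMeasure_withDensity hgi
  have : IsFiniteMeasure (ν.withDensity f) := isFiniteMeasure_withDensity hfi
  rw [← key hf, ← key hg]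
  exact klDiv_map_le _ _ hT.measurable

/-- Density of the scale mixture of `∏ N(c i, κ(r) w i)`. -/
def mixtureDensity (H : Measure ℝ) (κ : ℝ → ℝ) {n : ℕ} (c w u : Fin n → ℝ) : ℝ≥0∞ :=
  ∫⁻ r, ∏ i, gaussianPDF (c i) (κ r * w i).toNNReal (u i) ∂H

lemma measurable_uncurry_prod_gaussianPDFReal {R : Type*} [MeasurableSpace R] {n : ℕ}
    (c : Fin n → ℝ) {s : R → Fin n → ℝ} (hs : Measurable s) :
    Measurable fun p : R × (Fin n → ℝ) =>
      ∏ i, gaussianPDFReal (c i) (s p.1 i).toNNReal (p.2 i) := by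
  refine Finset.measurable_prod _ fun i _ => ?_
  exact measurable_uncurry_gaussianPDFReal.comp
    ((measurable_const (a := c i)).prodMk
      ((((measurable_pi_apply i).comp (hs.comp measurable_fst)).real_toNNReal).prodMk
        ((measurable_pi_apply i).comp measurable_snd)))

lemma measurable_mixtureDensity {H : Measure ℝ} [SFinite H] {κ : ℝ → ℝ} (hκ : Measurable κ)
    {n : ℕ} (c w : Fin n → ℝ) : Measurable (mixtureDensity H κ c w) := by
  unfold mixtureDensity
  simp only [prod_gaussianPDF_eq_ofReal]
  have hs : Measurable fun r i => κ r * w i := by fun_prop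
  exact Measurable.lintegral_prod_left'
    (f := fun p : ℝ × (Fin n → ℝ) =>
      ENNReal.ofReal (∏ i, gaussianPDFReal (c i) (κ p.1 * w i).toNNReal (p.2 i)))
    (measurable_uncurry_prod_gaussianPDFReal c hs).ennreal_ofReal

lemma lintegral_mixtureDensity {H : Measure ℝ} [IsProbabilityMeasure H] {κ : ℝ → ℝ}
    (hκ : Measurable κ) (hκ0 : ∀ᵐ r ∂H, 0 < κ r) {n : ℕ} (c : Fin n → ℝ) {w : Fin n → ℝ}
    (hw : ∀ i, 0 < w i) : ∫⁻ u, mixtureDensity H κ c w u = 1 := by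
  simp only [mixtureDensity]
  have hs : Measurable fun r i => κ r * w i := by fun_prop
  rw [lintegral_lintegral_swap]
  · calc _ = ∫⁻ r, 1 ∂H := by
          refine lintegral_congr_ae (hκ0.mono fun r hr => ?_)
          simp only
          rw [volume_pi, lintegral_fin_prod_eq_prod fun i => measurable_gaussianPDF _ _]
          refine Finset.prod_eq_one fun i _ => lintegral_gaussianPDF_eq_one _ ?_
          rw [Ne, Real.toNNReal_eq_zero, not_le]
          exact mul_pos hr (hw i)
      _ = 1 := by simp
  · simp only [prod_gaussianPDF_eq_ofReal]
    exact ((measurable_uncurry_prod_gaussianPDFReal c hs).ennreal_ofReal.comp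
      measurable_swap).aemeasurable

/-- In eigencoordinates of the Gram matrix both models are scale mixtures of product Gaussians. -/
lemma klDensity_le_klDiv_mixtureDensity {H : Measure ℝ} [IsProbabilityMeasure H] {κ : ℝ → ℝ}
    (hκ : Measurable κ) (hκ0 : ∀ᵐ r ∂H, 0 < κ r) {φ : ℝ} (hφ : 0 < φ) (τ₀ : 𝒳 → ℝ)
    {K : 𝒳 → 𝒳 → ℝ} {n : ℕ} (m : Fin n → ℝ) (X : Fin n → 𝒳) {O : Matrix (Fin n) (Fin n) ℝ}
    {l : Fin n → ℝ} (hO : Oᵀ * O = 1) (hO' : O * Oᵀ = 1) (hl : ∀ i, 0 ≤ l i)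
    (hS : (gram K X).PosSemidef) (hK : gram K X = O * diagonal l * Oᵀ) :
    klDensity (trueDensity H κ φ τ₀ m X) (modelDensity H κ φ K m X) ≤
      klDiv (volume.withDensity
          (mixtureDensity H κ (Oᵀ *ᵥ fun i => τ₀ (X i)) fun _ => φ))
        (volume.withDensity (mixtureDensity H κ 0 fun i => l i + φ)) := by
  have hw : ∀ i, 0 < l i + φ := fun i => add_pos_of_nonneg_of_pos (hl i) hφ
  set T : (Fin n → ℝ) → (Fin n → ℝ) := fun u i => m i + (O *ᵥ u) i
  set S : (Fin n → ℝ) → (Fin n → ℝ) := fun y => Oᵀ *ᵥ (y - m)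
  have hTS : ∀ y, T (S y) = y := fun y => by
    ext i; simp [T, S, mulVec_mulVec, hO']
  have hST : ∀ y, S (T y) = y := fun y => by
    have : (fun i => m i + (O *ᵥ y) i) - m = O *ᵥ y := by ext i; simp
    simp [T, S, this, mulVec_mulVec, hO]
  have hf : trueDensity H κ φ τ₀ m X =
      mixtureDensity H κ (Oᵀ *ᵥ fun i => τ₀ (X i)) (fun _ => φ) ∘ S := by
    ext y
    conv_lhs => rw [← hTS y]
    simp only [trueDensity, Function.comp_apply, mixtureDensity]
    exact lintegral_congr fun r => isoGaussianDensity_orthogonal hO hO' _ _ _ _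
  have hg : modelDensity H κ φ K m X = mixtureDensity H κ 0 (fun i => l i + φ) ∘ S := by
    ext y
    conv_lhs => rw [← hTS y]
    simp only [modelDensity, Function.comp_apply, mixtureDensity, hK]
    exact lintegral_congr_ae (hκ0.mono fun r hr =>
      lintegral_isoGaussianDensity_multivariateGaussian hO hO' hl hr hφ (hK ▸ hS) _ _)
  rw [klDensity, hf, hg]
  refine klDiv_withDensity_comp_le (measurePreserving_add_orthogonal_mulVec hO m) ?_ hST
    (measurable_mixtureDensity hκ _ _) (measurable_mixtureDensity hκ _ _) ?_ ?_
  · fun_prop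
  · rw [lintegral_mixtureDensity hκ hκ0 _ fun _ => hφ]; exact ENNReal.one_ne_top
  · rw [lintegral_mixtureDensity hκ hκ0 _ hw]; exact ENNReal.one_ne_top

/-- Widening the variance from `a w` to `s w` only increases the exponential, and lowers the
normalizing constant by `√(a/s) ≥ √(a/b)`. -/
lemma sqrt_mul_gaussianPDFReal_le {a b s w : ℝ} (ha : 0 < a) (has : a ≤ s) (hsb : s ≤ b)
    (hw : 0 < w) (x : ℝ) :
    √(a / b) * gaussianPDFReal 0 (a * w).toNNReal x ≤ gaussianPDFReal 0 (s * w).toNNReal x := by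
  have hs := ha.trans_le has
  have hb := hs.trans_le hsb
  simp only [gaussianPDFReal, Real.coe_toNNReal _ (mul_pos ha hw).le,
    Real.coe_toNNReal _ (mul_pos hs hw).le, sub_zero]
  rw [← mul_assoc]
  have e : √(a / b) * (√(2 * Real.pi * (a * w)))⁻¹ = (√(2 * Real.pi * (b * w)))⁻¹ := by
    rw [← Real.sqrt_inv, ← Real.sqrt_inv, ← Real.sqrt_mul (by positivity)]
    congr 1; field_simp
  rw [e]
  gcongr ?_ * ?_
  · gcongr
  · refine Real.exp_le_exp.2 ?_
    rw [neg_div, neg_div, neg_le_neg_iff]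
    gcongr

/-- Eigencoordinate bound on a Gaussian divergence: `t` is the scale of the first distribution and
`s ≥ t` that of the second. -/
lemma sum_gaussian_kl_le {n : ℕ} {l c : Fin n → ℝ} (hl : ∀ i, 0 ≤ l i) {φ ε t s : ℝ}
    (hφ : 0 < φ) (hε : 0 < ε) (ht : 0 < t) (hts : t ≤ s) (hεs : ε ≤ s) :
    ∑ i, (Real.log ((s * (l i + φ)) / (t * φ)) +
        (t * φ + c i ^ 2) / (s * (l i + φ)) - 1) / 2 ≤
      n / 2 * Real.log (s / t) + Real.log (∏ i, (1 + φ⁻¹ * l i)) +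
        (∑ i, c i ^ 2 / (l i + φ)) / ε := by
  have hs := ht.trans_le hts
  have h1 : ∀ i, 0 < 1 + φ⁻¹ * l i := fun i => by have := hl i; positivity
  have hterm : ∀ i, (Real.log ((s * (l i + φ)) / (t * φ)) +
      (t * φ + c i ^ 2) / (s * (l i + φ)) - 1) / 2 ≤
      Real.log (s / t) / 2 + Real.log (1 + φ⁻¹ * l i) + c i ^ 2 / (l i + φ) / ε := by
    intro i
    have hw : 0 < l i + φ := add_pos_of_nonneg_of_pos (hl i) hφ
    have e1 : (s * (l i + φ)) / (t * φ) = s / t * (1 + φ⁻¹ * l i) := by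
      field_simp; ring
    have e2 : Real.log ((s * (l i + φ)) / (t * φ)) =
        Real.log (s / t) + Real.log (1 + φ⁻¹ * l i) := by
      rw [e1, Real.log_mul (div_pos hs ht).ne' (h1 i).ne']
    have e3 : 0 ≤ Real.log (1 + φ⁻¹ * l i) :=
      Real.log_nonneg (le_add_of_nonneg_right (mul_nonneg (inv_pos.2 hφ).le (hl i)))
    have e4 : t * φ / (s * (l i + φ)) ≤ 1 := by
      rw [div_le_one (mul_pos hs hw)]
      exact mul_le_mul hts (le_add_of_nonneg_left (hl i)) hφ.le hs.le
    have e5 : c i ^ 2 / (s * (l i + φ)) ≤ c i ^ 2 / (l i + φ) / ε := by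
      rw [div_div, mul_comm s]
      gcongr
    have e6 : 0 ≤ c i ^ 2 / (l i + φ) / ε := by positivity
    rw [e2, add_div]
    linarith
  calc _ ≤ ∑ i, (Real.log (s / t) / 2 + Real.log (1 + φ⁻¹ * l i) + c i ^ 2 / (l i + φ) / ε) :=
        Finset.sum_le_sum fun i _ => hterm i
    _ = _ := by
        rw [Finset.sum_add_distrib, Finset.sum_add_distrib, Real.log_prod fun i _ => (h1 i).ne',
          Finset.sum_div]
        simp; ring

set_option maxHeartbeats 1000000 in
/-- Divergence bound for scale mixtures of product Gaussians. The components whose scale is below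
`ε` are compared with the components whose scale lies in `[a, b]`. -/
lemma klDiv_mixtureDensity_le {H : Measure ℝ} [IsProbabilityMeasure H] {κ : ℝ → ℝ}
    (hκ : Measurable κ) (hκ0 : ∀ᵐ r ∂H, 0 < κ r) {φ : ℝ} (hφ : 0 < φ) {n : ℕ}
    (c : Fin n → ℝ) {l : Fin n → ℝ} (hl : ∀ i, 0 ≤ l i) {a b ε : ℝ} (hε : 0 < ε) (hεa : ε ≤ a)
    (hab : a ≤ b) (hη : 0 < H.real {r | a ≤ κ r ∧ κ r ≤ b}) :
    klDiv (volume.withDensity (mixtureDensity H κ c fun _ => φ))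
        (volume.withDensity (mixtureDensity H κ 0 fun i => l i + φ)) ≤
      ENNReal.ofReal (Real.log (∏ i, (1 + φ⁻¹ * l i))) +
      ENNReal.ofReal ((∑ i, c i ^ 2 / (l i + φ)) / ε +
        (Real.log 2 - Real.log (H.real {r | a ≤ κ r ∧ κ r ≤ b}))) +
      n * ∫⁻ r in {r | κ r < ε}, ENNReal.ofReal (Real.log b - Real.log (κ r)) ∂H + 1 := by
  set A := {r | a ≤ κ r ∧ κ r ≤ b}
  set η := H.real A
  have hA : MeasurableSet A :=
    (measurableSet_le measurable_const hκ).inter (measurableSet_le hκ measurable_const)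
  have hE : MeasurableSet {r | κ r < ε} := measurableSet_lt hκ measurable_const
  have ha : 0 < a := hε.trans_le hεa
  have hb : 0 < b := ha.trans_le hab
  have hη1 : η ≤ 1 := measureReal_le_one
  have hw : ∀ i, 0 < l i + φ := fun i => add_pos_of_nonneg_of_pos (hl i) hφ
  have hq0 : 0 < √(a / b) := Real.sqrt_pos.2 (div_pos ha hb)
  have hq1 : √(a / b) ≤ 1 := by
    exact Real.sqrt_le_iff.2 ⟨zero_le_one, by rw [one_pow]; exact (div_le_one hb).2 hab⟩
  -- Weights and scales of a sub-mixture lying below the model density. Half of the model keeps its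
  -- own components with `κ r ≥ ε`. The other half serves the small scales: the window `A` has mass
  -- `η`, and each of its components dominates `√(a/b) ^ n` times the component of scale `a`.
  set θ : ℝ → ℝ := fun r => if κ r < ε then 2⁻¹ * (η * √(a / b) ^ n) else 2⁻¹
  set s : ℝ → ℝ := fun r => if κ r < ε then a else κ r
  have hθ0 : ∀ r, 0 < θ r := fun r => by simp only [θ]; split_ifs <;> positivity
  have hθ1 : ∀ r, θ r ≤ 1 := fun r => by
    simp only [θ]; split_ifs
    · have := mul_le_one₀ hη1 (by positivity) (pow_le_one₀ hq0.le hq1 (n := n))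
      linarith
    · norm_num
  have hθm : Measurable θ := Measurable.ite hE measurable_const measurable_const
  have hsm : Measurable s := Measurable.ite hE measurable_const hκ
  have hs0 : ∀ r, 0 < s r := fun r => by
    simp only [s]; split_ifs with h
    · exact ha
    · exact hε.trans_le (not_lt.1 h)
  have hnn : ∀ {x : ℝ}, 0 < x → x.toNNReal ≠ 0 := fun hx => by
    rwa [Ne, Real.toNNReal_eq_zero, not_le]
  set F : ℝ → (Fin n → ℝ) → ℝ := fun r u => ∏ i, gaussianPDFReal (c i) (κ r * φ).toNNReal (u i)
  set N : ℝ → (Fin n → ℝ) → ℝ := fun t u =>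
    ∏ i, gaussianPDFReal 0 (t * (l i + φ)).toNNReal (u i)
  set G : ℝ → (Fin n → ℝ) → ℝ := fun r u => θ r * N (s r) u
  have hN0 : ∀ t, 0 < t → ∀ u, 0 < N t u := fun t ht u =>
    Finset.prod_pos fun i _ => gaussianPDFReal_pos _ _ _ (hnn (mul_pos ht (hw i)))
  have hmix : ∀ u, mixtureDensity H κ 0 (fun i => l i + φ) u =
      ∫⁻ r, ENNReal.ofReal (N (κ r) u) ∂H := fun u =>
    lintegral_congr fun r => prod_gaussianPDF_eq_ofReal _ _ _
  have hFm : Measurable (Function.uncurry F) :=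
    measurable_uncurry_prod_gaussianPDFReal (s := fun r (_ : Fin n) => κ r * φ) c (by fun_prop)
  have hGm : Measurable (Function.uncurry G) :=
    (hθm.comp measurable_fst).mul (measurable_uncurry_prod_gaussianPDFReal
      (s := fun r i => s r * (l i + φ)) 0 (by fun_prop))
  have hNm : ∀ u, Measurable fun r => N (κ r) u := fun u =>
    (measurable_uncurry_prod_gaussianPDFReal (s := fun r i => κ r * (l i + φ)) 0
      (by fun_prop)).comp measurable_prodMk_right
  have hGg : ∀ u, ∫⁻ r, ENNReal.ofReal (G r u) ∂H ≤
      mixtureDensity H κ 0 (fun i => l i + φ) u := by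
    intro u
    have hhalf : ENNReal.ofReal (2⁻¹ * (η * √(a / b) ^ n * N a u)) ≤
        2⁻¹ * mixtureDensity H κ 0 (fun i => l i + φ) u := by
      rw [ENNReal.ofReal_mul (by norm_num), ENNReal.ofReal_inv_of_pos (by norm_num),
        ENNReal.ofReal_ofNat]
      gcongr
      rw [hmix, mul_assoc, ENNReal.ofReal_mul hη.le, ofReal_measureReal, mul_comm]
      calc _ = ∫⁻ _ in A, ENNReal.ofReal (√(a / b) ^ n * N a u) ∂H := by
            rw [setLIntegral_const]
        _ ≤ ∫⁻ r in A, ENNReal.ofReal (N (κ r) u) ∂H := by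
            refine setLIntegral_mono' hA fun r hr => ENNReal.ofReal_le_ofReal ?_
            simp only [N]
            have : √(a / b) ^ n = ∏ _i : Fin n, √(a / b) := by simp
            rw [this, ← Finset.prod_mul_distrib]
            exact Finset.prod_le_prod
              (fun i _ => mul_nonneg hq0.le (gaussianPDFReal_nonneg _ _ _))
              fun i _ => sqrt_mul_gaussianPDFReal_le ha hr.1 hr.2 (hw i) _
        _ ≤ _ := setLIntegral_le_lintegral _ _
    calc ∫⁻ r, ENNReal.ofReal (G r u) ∂H
        ≤ ∫⁻ r, (ENNReal.ofReal (2⁻¹ * (η * √(a / b) ^ n * N a u)) +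
            2⁻¹ * ENNReal.ofReal (N (κ r) u)) ∂H := by
          refine lintegral_mono fun r => ?_
          simp only [G, θ, s]
          split_ifs
          · refine le_add_right (le_of_eq ?_)
            congr 1; ring
          · refine le_add_left (le_of_eq ?_)
            rw [ENNReal.ofReal_mul (by norm_num), ENNReal.ofReal_inv_of_pos (by norm_num),
              ENNReal.ofReal_ofNat]
      _ = ENNReal.ofReal (2⁻¹ * (η * √(a / b) ^ n * N a u)) +
            2⁻¹ * mixtureDensity H κ 0 (fun i => l i + φ) u := by
          rw [lintegral_add_left measurable_const,
            lintegral_const_mul _ (hNm u).ennreal_ofReal, hmix]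
          simp
      _ ≤ 2⁻¹ * mixtureDensity H κ 0 (fun i => l i + φ) u +
            2⁻¹ * mixtureDensity H κ 0 (fun i => l i + φ) u := by gcongr
      _ = _ := by rw [← add_mul, ENNReal.inv_two_add_inv_two, one_mul]
  have hkl := klDiv_mixture_le (ν := (volume : Measure (Fin n → ℝ))) (H := H)
    (f := mixtureDensity H κ c fun _ => φ)
    (g := mixtureDensity H κ 0 fun i => l i + φ) hFm hGm
    (hκ0.mono fun r hr u =>
      Finset.prod_pos fun i _ => gaussianPDFReal_pos _ _ _ (hnn (mul_pos hr hφ)))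
    (.of_forall fun r u => mul_pos (hθ0 r) (hN0 _ (hs0 r) u))
    (fun u => lintegral_congr fun r => prod_gaussianPDF_eq_ofReal _ _ _)
    (measurable_mixtureDensity hκ _ _) hGg
    (by rw [lintegral_mixtureDensity hκ hκ0 c fun _ => hφ]; exact ENNReal.one_ne_top)
    (lintegral_mixtureDensity hκ hκ0 0 hw).le
  refine hkl.trans ?_
  gcongr ?_ + 1
  set L := Real.log (∏ i, (1 + φ⁻¹ * l i))
  set Q := (∑ i, c i ^ 2 / (l i + φ)) / ε
  have hL : 0 ≤ L := by
    refine Real.log_nonneg ?_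
    have := Finset.prod_le_prod (s := Finset.univ) (f := fun _ : Fin n => (1 : ℝ))
      (g := fun i => 1 + φ⁻¹ * l i) (fun _ _ => zero_le_one)
      (fun i _ => le_add_of_nonneg_right (mul_nonneg (inv_pos.2 hφ).le (hl i)))
    simpa using this
  have hQ : 0 ≤ Q := div_nonneg
    (Finset.sum_nonneg fun i _ => div_nonneg (sq_nonneg _) (hw i).le) hε.le
  have hlogη : Real.log η ≤ 0 := Real.log_nonpos hη.le hη1
  have hlog2 : 0 ≤ Real.log 2 := Real.log_nonneg (by norm_num)
  have hC : 0 ≤ Q + (Real.log 2 - Real.log η) := by linarith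
  calc _ ≤ ∫⁻ r, (ENNReal.ofReal L + ENNReal.ofReal (Q + (Real.log 2 - Real.log η)) +
          n * {r | κ r < ε}.indicator
            (fun r => ENNReal.ofReal (Real.log b - Real.log (κ r))) r) ∂H := by
        refine lintegral_mono_ae (hκ0.mono fun r hr => ?_)
        have hv : ∀ i, (s r * (l i + φ)).toNNReal ≠ 0 := fun i => hnn (mul_pos (hs0 r) (hw i))
        refine (lintegral_klFun_gaussian_le c (hnn (mul_pos hr hφ)) hv (hθ0 r) (hθ1 r)).trans ?_
        have hco : ∀ i, ((s r * (l i + φ)).toNNReal : ℝ) = s r * (l i + φ) := fun i =>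
          Real.coe_toNNReal _ (mul_pos (hs0 r) (hw i)).le
        simp only [hco, Real.coe_toNNReal _ (mul_pos hr hφ).le]
        have hts : κ r ≤ s r := by
          simp only [s]; split_ifs with h
          · exact (h.trans_le hεa).le
          · exact le_rfl
        have hes : ε ≤ s r := by
          simp only [s]; split_ifs with h
          · exact hεa
          · exact not_lt.1 h
        have hsum := sum_gaussian_kl_le (c := c) hl hφ hε hr hts hes
        by_cases h : κ r < ε
        · have hind : {r | κ r < ε}.indicator
              (fun r => ENNReal.ofReal (Real.log b - Real.log (κ r))) r =
              ENNReal.ofReal (Real.log b - Real.log (κ r)) :=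
            Set.indicator_of_mem (s := {r | κ r < ε}) h _
          have hkb : Real.log (κ r) ≤ Real.log b :=
            Real.log_le_log hr ((h.trans_le hεa).le.trans hab)
          have hp : 0 ≤ n * (Real.log b - Real.log (κ r)) :=
            mul_nonneg (Nat.cast_nonneg _) (sub_nonneg.2 hkb)
          rw [hind, ← ENNReal.ofReal_natCast, ← ENNReal.ofReal_mul (Nat.cast_nonneg _),
            ← ENNReal.ofReal_add hL hC, ← ENNReal.ofReal_add (add_nonneg hL hC) hp]
          refine ENNReal.ofReal_le_ofReal ?_
          -- The term `(n/2)(log b - log a)` of `-log θ` adds to `(n/2)(log a - log κ r)` from the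
          -- change of scale. The total `(n/2)(log b - log κ r)` is at most the `n (log b - log κ
          -- r)` allowed.
          have hlθ : Real.log (θ r) =
              -Real.log 2 + (Real.log η + n * ((Real.log a - Real.log b) / 2)) := by
            simp only [θ, if_pos h]
            rw [Real.log_mul (by norm_num) (by positivity), Real.log_inv,
              Real.log_mul hη.ne' (by positivity), Real.log_pow,
              Real.log_sqrt (by positivity), Real.log_div ha.ne' hb.ne']
          have hsr : s r = a := if_pos h
          rw [hsr, Real.log_div ha.ne' hr.ne'] at hsum
          rw [hsr, hlθ]
          linarith
        · have hind : {r | κ r < ε}.indicator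
              (fun r => ENNReal.ofReal (Real.log b - Real.log (κ r))) r = 0 :=
            Set.indicator_of_notMem (s := {r | κ r < ε}) h _
          rw [hind, mul_zero, add_zero, ← ENNReal.ofReal_add hL hC]
          refine ENNReal.ofReal_le_ofReal ?_
          have hlθ : Real.log (θ r) = -Real.log 2 := by
            simp only [θ, if_neg h, Real.log_inv]
          have hsr : s r = κ r := if_neg h
          rw [hsr, div_self hr.ne', Real.log_one, mul_zero, zero_add] at hsum
          rw [hsr, hlθ]
          linarith
    _ = _ := by
        have hmi : Measurable fun r => ENNReal.ofReal (Real.log b - Real.log (κ r)) := by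
          fun_prop
        rw [lintegral_add_left measurable_const, lintegral_const, measure_univ, mul_one,
          lintegral_const_mul _ (hmi.indicator hE), lintegral_indicator hE]

/-! ### Signals in the RKHS and the pointwise divergence bound -/

lemma IsCovKernel.gram_posSemidef {K : 𝒳 → 𝒳 → ℝ} (hK : IsCovKernel K) {n : ℕ} (X : Fin n → 𝒳) :
    (gram K X).PosSemidef :=
  PosSemidef.submatrix hK X

/-- By the reproducing property the left side is the squared inner product of `f` with `∑ aᵢ K(xᵢ,
·)`, whose squared norm is the quadratic form; Cauchy–Schwarz concludes. -/
lemma RKHSNormLE.sq_dotProduct_le {K : 𝒳 → 𝒳 → ℝ} {f : 𝒳 → ℝ} {B : ℝ} (h : RKHSNormLE K f B)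
    {n : ℕ} (X : Fin n → 𝒳) (a : Fin n → ℝ) :
    (a ⬝ᵥ fun i => f (X i)) ^ 2 ≤ B ^ 2 * (a ⬝ᵥ (gram K X *ᵥ a)) := by
  obtain ⟨F, _, _, _, _, hK, g, rfl, hB⟩ := h
  set v : F := ∑ i, a i • RKHS.kerFun F (X i) (1 : ℝ)
  have h1 : inner ℝ v g = a ⬝ᵥ fun i => g (X i) := by
    simp [v, sum_inner, real_inner_smul_left, dotProduct]
  have h2 : ‖v‖ ^ 2 = a ⬝ᵥ (gram K X *ᵥ a) := by
    rw [← real_inner_self_eq_norm_sq]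
    simp only [v, sum_inner, inner_sum, real_inner_smul_left, real_inner_smul_right, dotProduct,
      mulVec, gram, of_apply, Finset.mul_sum]
    refine Finset.sum_congr rfl fun i _ => Finset.sum_congr rfl fun j _ => ?_
    rw [← RKHS.kernel_inner, hK]
    simp
    exact Or.inl (mul_comm _ _)
  have h3 := abs_real_inner_le_norm v g
  rw [← h1, ← h2, ← sq_abs, ← mul_pow, mul_comm B]
  exact pow_le_pow_left₀ (abs_nonneg _)
    (h3.trans (mul_le_mul_of_nonneg_left hB (norm_nonneg _))) 2

lemma dotProduct_gram_mulVec_le {K C : 𝒳 → 𝒳 → ℝ} {δ : ℝ} (hδ : ∀ x x', |K x x' - C x x'| ≤ δ)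
    {n : ℕ} (X : Fin n → 𝒳) (a : Fin n → ℝ) :
    a ⬝ᵥ (gram C X *ᵥ a) ≤ a ⬝ᵥ (gram K X *ᵥ a) + n * δ * (a ⬝ᵥ a) := by
  rcases n.eq_zero_or_pos with rfl | hn
  · simp
  have hδ0 : 0 ≤ δ := (abs_nonneg _).trans (hδ (X ⟨0, hn⟩) (X ⟨0, hn⟩))
  have h1 : a ⬝ᵥ (gram C X *ᵥ a) - a ⬝ᵥ (gram K X *ᵥ a) ≤ (∑ i, |a i|) ^ 2 * δ := by
    simp only [dotProduct, mulVec, gram, of_apply, Finset.mul_sum]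
    rw [← Finset.sum_sub_distrib, sq, Finset.sum_mul_sum, Finset.sum_mul]
    refine Finset.sum_le_sum fun i _ => ?_
    rw [← Finset.sum_sub_distrib, Finset.sum_mul]
    refine Finset.sum_le_sum fun j _ => ?_
    calc _ = -(a i * a j * (K (X i) (X j) - C (X i) (X j))) := by ring
      _ ≤ |a i * a j * (K (X i) (X j) - C (X i) (X j))| := neg_le_abs _
      _ ≤ _ := by
        rw [abs_mul, abs_mul]
        exact mul_le_mul_of_nonneg_left (hδ _ _) (by positivity)
  have h2 : (∑ i, |a i|) ^ 2 ≤ n * (a ⬝ᵥ a) := by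
    have := sq_sum_le_card_mul_sum_sq (s := Finset.univ) (f := fun i => |a i|)
    simpa [dotProduct, sq] using this
  nlinarith [mul_le_mul_of_nonneg_right h2 hδ0]

/-- Pointwise divergence bound in terms of the regret of the plugged-in kernel `K`, for a signal
in the RKHS of a kernel `C` at uniform distance at most `δ` from `K`. -/
lemma klDensity_le {H : Measure ℝ} [IsProbabilityMeasure H] {κ : ℝ → ℝ}
    (hκ : Measurable κ) (hκ0 : ∀ᵐ r ∂H, 0 < κ r) {φ : ℝ} (hφ : 0 < φ) {τ₀ : 𝒳 → ℝ}
    {K C : 𝒳 → 𝒳 → ℝ} (hK : IsCovKernel K) {B : ℝ} (hτ : RKHSNormLE C τ₀ B) {δ : ℝ} (hδ0 : 0 ≤ δ)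
    (hδ : ∀ x x', |K x x' - C x x'| ≤ δ) {a b ε : ℝ} (hε : 0 < ε) (hεa : ε ≤ a)
    (hab : a ≤ b) (hη : 0 < H.real {r | a ≤ κ r ∧ κ r ≤ b}) {n : ℕ} (m : Fin n → ℝ)
    (X : Fin n → 𝒳) :
    klDensity (trueDensity H κ φ τ₀ m X) (modelDensity H κ φ K m X) ≤
      ENNReal.ofReal (Real.log (1 + φ⁻¹ • gram K X).det) +
      (ENNReal.ofReal (B ^ 2 * (1 + n * δ / φ) / ε +
        (Real.log 2 - Real.log (H.real {r | a ≤ κ r ∧ κ r ≤ b}))) +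
      n * ∫⁻ r in {r | κ r < ε}, ENNReal.ofReal (Real.log b - Real.log (κ r)) ∂H + 1) := by
  have hS := hK.gram_posSemidef X
  obtain ⟨O, l, hO, hO', hl, hSO⟩ := exists_orthogonal_diagonalization hS
  refine (klDensity_le_klDiv_mixtureDensity hκ hκ0 hφ τ₀ m X hO hO' hl hS hSO).trans ?_
  refine (klDiv_mixtureDensity_le hκ hκ0 hφ _ hl hε hεa hab hη).trans ?_
  rw [← det_one_add_smul_of_diagonalization hO', ← hSO]
  -- The RKHS bound involves `C`. Passing to `K` adds `nδ |v|²`, which the noise term `φ |v|²`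
  -- absorbs at the price of the factor `1 + nδ/φ`.
  have hQ : ∑ i, (Oᵀ *ᵥ fun i => τ₀ (X i)) i ^ 2 / (l i + φ) ≤ B ^ 2 * (1 + n * δ / φ) := by
    refine sum_sq_div_le_of_quadratic_form_le hO hl hφ (by positivity) _ fun v => ?_
    rw [← hSO]
    have h1 := hτ.sq_dotProduct_le X v
    have h2 := dotProduct_gram_mulVec_le hδ X v
    have h3 : 0 ≤ v ⬝ᵥ (gram K X *ᵥ v) := by simpa using hS.dotProduct_mulVec_nonneg v
    have h4 : 0 ≤ v ⬝ᵥ v := by simpa using dotProduct_self_star_nonneg v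
    refine h1.trans ?_
    rw [mul_assoc]
    refine mul_le_mul_of_nonneg_left (h2.trans ?_) (sq_nonneg B)
    have h5 : 0 ≤ n * δ / φ * (v ⬝ᵥ (gram K X *ᵥ v)) := by positivity
    have h6 : 0 ≤ φ * (v ⬝ᵥ v) := by positivity
    have h7 : n * δ / φ * (φ * (v ⬝ᵥ v)) = n * δ * (v ⬝ᵥ v) := by field_simp
    nlinarith
  rw [add_assoc, add_assoc, add_assoc]
  gcongr

/-! ### Expected regret under uniform perturbation of the kernel -/

section Regret

variable [MeasurableSpace 𝒳] {U : Measure 𝒳} [IsProbabilityMeasure U]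

lemma measurePreserving_pi_comp {ι ι' : Type*} [Fintype ι] [Fintype ι'] {e : ι' → ι}
    (he : Function.Injective e) :
    MeasurePreserving (fun (X : ι → 𝒳) i => X (e i)) (Measure.pi fun _ => U)
      (Measure.pi fun _ => U) := by
  refine ⟨by fun_prop, ?_⟩
  have h : iIndepFun (fun (i : ι) (X : ι → 𝒳) => X i) (Measure.pi fun _ : ι => U) :=
    iIndepFun_pi (X := fun _ x => x) fun _ => aemeasurable_id
  have h2 := (iIndepFun_iff_map_fun_eq_pi_map
    (fun i => (measurable_pi_apply (e i)).aemeasurable)).1 (h.precomp he)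
  rw [h2]
  congr 1; ext1 i
  exact (measurePreserving_eval (fun _ : ι => U) (e i)).map_eq

lemma measurable_regret {K : 𝒳 → 𝒳 → ℝ} (hK : Measurable (Function.uncurry K)) (φ : ℝ) (n : ℕ) :
    Measurable fun X : Fin n → 𝒳 =>
      ENNReal.ofReal (Real.log (1 + φ⁻¹ • gram K X).det) := by
  refine (Real.measurable_log.comp ?_).ennreal_ofReal
  simp only [det_apply]
  refine Finset.measurable_sum _ fun σ _ => Measurable.const_smul ?_ _
  refine Finset.measurable_prod _ fun i _ => ?_
  simp only [Matrix.add_apply, Matrix.smul_apply, gram, of_apply, smul_eq_mul]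
  have hKX : Measurable fun X : Fin n → 𝒳 => K (X (σ i)) (X i) :=
    hK.comp (show Measurable fun X : Fin n → 𝒳 => (X (σ i), X i) by fun_prop)
  exact measurable_const.add (measurable_const.mul hKX)

/-- Approximate subadditivity: the two parts of an i.i.d. design are again i.i.d. designs. Only the
first block is moved from `K` to `C`, so the error involves `m` alone and the inequality can be
iterated on the second. -/
lemma expectedRegret_add_le {K C : 𝒳 → 𝒳 → ℝ} (hK : IsCovKernel K) (hC : IsCovKernel C)
    (hKm : Measurable (Function.uncurry K)) (hCm : Measurable (Function.uncurry C)) {φ δ : ℝ}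
    (hφ : 0 < φ) (hδ0 : 0 ≤ δ) (hδ : ∀ x x', |K x x' - C x x'| ≤ δ) (m k : ℕ) :
    expectedRegret U φ K (m + k) ≤
      expectedRegret U φ C m + ENNReal.ofReal (m ^ 2 * δ / φ) + expectedRegret U φ K k := by
  have hφ' : 0 ≤ φ⁻¹ := (inv_pos.2 hφ).le
  have hpt : ∀ X : Fin (m + k) → 𝒳,
      ENNReal.ofReal (Real.log (1 + φ⁻¹ • gram K X).det) ≤
        ENNReal.ofReal (Real.log (1 + φ⁻¹ • gram C fun i => X (Fin.castAdd k i)).det) +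
        ENNReal.ofReal (m ^ 2 * δ / φ) +
        ENNReal.ofReal (Real.log (1 + φ⁻¹ • gram K fun i => X (Fin.natAdd m i)).det) := by
    intro X
    have p1 := log_det_one_add_nonneg (hC.gram_posSemidef fun i => X (Fin.castAdd k i)) hφ'
    have p2 := log_det_one_add_nonneg (hK.gram_posSemidef fun i => X (Fin.natAdd m i)) hφ'
    have p3 : 0 ≤ m ^ 2 * δ / φ := by positivity
    rw [← ENNReal.ofReal_add p1 p3, ← ENNReal.ofReal_add (add_nonneg p1 p3) p2]
    refine ENNReal.ofReal_le_ofReal ?_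
    set T : Matrix (Fin m ⊕ Fin k) (Fin m ⊕ Fin k) ℝ :=
      (φ⁻¹ • gram K X).submatrix finSumFinEquiv finSumFinEquiv
    have hT : T.PosSemidef := ((hK.gram_posSemidef X).smul hφ').submatrix _
    have hS : (φ⁻¹ • gram C fun i => X (Fin.castAdd k i)).PosSemidef :=
      (hC.gram_posSemidef _).smul hφ'
    have h := log_det_one_add_fromBlocks_le (d := φ⁻¹ * δ) hS hT fun i j => by
      simp only [T, submatrix_apply, Matrix.smul_apply, gram, of_apply, smul_eq_mul,
        finSumFinEquiv_apply_left]
      rw [← mul_sub, abs_mul, abs_of_nonneg hφ']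
      exact mul_le_mul_of_nonneg_left (hδ _ _) hφ'
    have e1 : (1 + T).det = (1 + φ⁻¹ • gram K X).det := by
      rw [← det_submatrix_equiv_self finSumFinEquiv (1 + φ⁻¹ • gram K X)]
      congr 1
      ext i j
      simp [T, one_apply]
    have e2 : T.submatrix Sum.inr Sum.inr = φ⁻¹ • gram K fun i => X (Fin.natAdd m i) := by
      ext i j; simp [T, gram]
    have e3 : (m : ℝ) ^ 2 * (φ⁻¹ * δ) = m ^ 2 * δ / φ := by field_simp
    rw [e1, e2, Fintype.card_fin, e3] at h
    exact h
  have m1 := measurePreserving_pi_comp (U := U) (e := Fin.castAdd (n := m) k)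
    (Fin.castAdd_injective m k)
  have m2 := measurePreserving_pi_comp (U := U) (e := fun i : Fin k => Fin.natAdd m i)
    (Fin.natAdd_injective k m)
  calc expectedRegret U φ K (m + k)
      ≤ ∫⁻ X, _ ∂(Measure.pi fun _ : Fin (m + k) => U) := lintegral_mono hpt
    _ = _ := by
        have f2 : Measurable fun X : Fin (m + k) → 𝒳 => ENNReal.ofReal
            (Real.log (1 + φ⁻¹ • gram K fun i => X (Fin.natAdd m i)).det) :=
          (measurable_regret hKm φ k).comp m2.measurable
        rw [lintegral_add_right _ f2, lintegral_add_right _ measurable_const, lintegral_const, measure_univ, mul_one,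
          expectedRegret, expectedRegret, ← m1.lintegral_comp (measurable_regret hCm φ m),
          ← m2.lintegral_comp (measurable_regret hKm φ k)]

lemma expectedRegret_mul_add_le {K C : 𝒳 → 𝒳 → ℝ} (hK : IsCovKernel K) (hC : IsCovKernel C)
    (hKm : Measurable (Function.uncurry K)) (hCm : Measurable (Function.uncurry C)) {φ δ : ℝ}
    (hφ : 0 < φ) (hδ0 : 0 ≤ δ) (hδ : ∀ x x', |K x x' - C x x'| ≤ δ) (m j q : ℕ) :
    expectedRegret U φ K (q * m + j) ≤
      q * (expectedRegret U φ C m + ENNReal.ofReal (m ^ 2 * δ / φ)) +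
        (expectedRegret U φ C j + ENNReal.ofReal (j ^ 2 * δ / φ)) := by
  induction q with
  | zero =>
    have h := expectedRegret_add_le (U := U) hK hC hKm hCm hφ hδ0 hδ j 0
    have h0 : expectedRegret U φ K 0 = 0 := by simp [expectedRegret]
    rw [h0, add_zero] at h
    simpa using h
  | succ q ih =>
    have e : (q + 1) * m + j = m + (q * m + j) := by ring
    rw [e]
    refine (expectedRegret_add_le hK hC hKm hCm hφ hδ0 hδ m _).trans ?_
    push_cast
    rw [add_mul, one_mul, add_comm (_ * _) (_ + _), add_assoc (_ + _)]
    gcongr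

/-- A vanishing expected regret rate is inherited by kernels converging uniformly. -/
lemma tendsto_expectedRegret_div {C : 𝒳 → 𝒳 → ℝ} {K : ℕ → 𝒳 → 𝒳 → ℝ}
    (hK : ∀ n, IsCovKernel (K n)) (hC : IsCovKernel C)
    (hKm : ∀ n, Measurable (Function.uncurry (K n))) (hCm : Measurable (Function.uncurry C))
    {φ : ℝ} (hφ : 0 < φ) (hunif : ∀ δ > 0, ∀ᶠ n in atTop, ∀ x x', |K n x x' - C x x'| ≤ δ)
    (hreg : Tendsto (fun n : ℕ => expectedRegret U φ C n / n) atTop (𝓝 0)) :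
    Tendsto (fun n : ℕ => expectedRegret U φ (K n) n / n) atTop (𝓝 0) := by
  rw [ENNReal.tendsto_nhds_zero] at hreg ⊢
  intro e he
  have he3 : 0 < e / 3 := ENNReal.div_pos he.ne' (by simp)
  obtain ⟨M, hM⟩ := eventually_atTop.1 ((hreg 1 one_pos).and (hreg (e / 3) he3))
  set m := M + 1
  have hm0 : (0 : ℝ) < m := by positivity
  -- The rate condition directly gives finiteness only for large `j`. The leftover block is
  -- therefore given a size in `[m, 2m)` rather than `n % m`.
  have hfin : ∀ j, m ≤ j → expectedRegret U φ C j ≠ ∞ := by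
    intro j hj htop
    have := (hM j (by omega)).1
    rw [htop, ENNReal.top_div_of_ne_top (ENNReal.natCast_ne_top j)] at this
    simp at this
  obtain ⟨ρ, hρ0, hρ⟩ := ENNReal.lt_iff_exists_nnreal_btwn.1 he3
  have hρ0' : (0 : ℝ) < ρ := by exact_mod_cast hρ0
  -- Makes the error per observation `mδ/φ` at most `ρ < e / 3`, for the block size `m` already
  -- fixed.
  set δ : ℝ := min 1 (ρ * φ / m)
  have hδ : 0 < δ := lt_min one_pos (by positivity)
  set D : ℝ≥0∞ := ∑ j ∈ Finset.Ico m (2 * m),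
    (expectedRegret U φ C j + ENNReal.ofReal (j ^ 2 * δ / φ))
  have hD : D ≠ ∞ := by
    refine ENNReal.sum_ne_top.2 fun j hj => ENNReal.add_ne_top.2
      ⟨hfin j (Finset.mem_Ico.1 hj).1, ENNReal.ofReal_ne_top⟩
  have hDn : Tendsto (fun n : ℕ => D / n) atTop (𝓝 0) := by
    have := ENNReal.Tendsto.const_div (a := D) ENNReal.tendsto_nat_nhds_top (Or.inr hD)
    rwa [ENNReal.div_top] at this
  filter_upwards [hunif δ hδ, (ENNReal.tendsto_nhds_zero.1 hDn) _ he3, eventually_ge_atTop m]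
    with n h1 h2 h3
  have hn0 : (n : ℝ≥0∞) ≠ 0 := by
    have : n ≠ 0 := by omega
    exact_mod_cast this
  obtain ⟨q, hq⟩ : ∃ q, n / m = q + 1 :=
    Nat.exists_eq_succ_of_ne_zero (Nat.div_pos h3 (by omega)).ne'
  set j := m + n % m
  have hnj : n = q * m + j := by
    have := Nat.div_add_mod n m
    rw [hq] at this
    simp only [j]; nlinarith
  have hj : j ∈ Finset.Ico m (2 * m) := by
    have := Nat.mod_lt n (show 0 < m by omega)
    rw [Finset.mem_Ico]; omega
  have hb := expectedRegret_mul_add_le (U := U) (hK n) hC (hKm n) hCm hφ hδ.le h1 m j q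
  rw [← hnj] at hb
  have hjD : expectedRegret U φ C j + ENNReal.ofReal (j ^ 2 * δ / φ) ≤ D :=
    Finset.single_le_sum (f := fun j : ℕ => expectedRegret U φ C j +
      ENNReal.ofReal (j ^ 2 * δ / φ)) (fun _ _ => bot_le) hj
  have hm0' : (m : ℝ≥0∞) ≠ 0 := by simp [m]
  have hqn : (q : ℝ≥0∞) / n ≤ 1 / m := by
    rw [ENNReal.div_le_iff hn0 (ENNReal.natCast_ne_top n), ENNReal.div_eq_inv_mul, mul_one,
      ← ENNReal.div_eq_inv_mul, ENNReal.le_div_iff_mul_le (Or.inl hm0')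
      (Or.inl (ENNReal.natCast_ne_top m))]
    have : q * m ≤ n := by omega
    exact_mod_cast this
  have hmδ : ENNReal.ofReal (m ^ 2 * δ / φ) / m ≤ e / 3 := by
    rw [← ENNReal.ofReal_natCast m, ← ENNReal.ofReal_div_of_pos hm0]
    refine le_trans (ENNReal.ofReal_le_ofReal (q := (ρ : ℝ)) ?_) (by simpa using hρ.le)
    have : δ ≤ ρ * φ / m := min_le_right _ _
    calc (m : ℝ) ^ 2 * δ / φ / m = m * δ / φ := by field_simp
      _ ≤ m * (ρ * φ / m) / φ := by gcongr
      _ = ρ := by field_simp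
  calc expectedRegret U φ (K n) n / n
      ≤ (q * (expectedRegret U φ C m + ENNReal.ofReal (m ^ 2 * δ / φ)) + D) / n := by
        gcongr; exact hb.trans (by gcongr)
    _ = q / n * (expectedRegret U φ C m + ENNReal.ofReal (m ^ 2 * δ / φ)) + D / n := by
        rw [ENNReal.add_div]; congr 1
        simp only [div_eq_mul_inv]; ring
    _ ≤ 1 / m * (expectedRegret U φ C m + ENNReal.ofReal (m ^ 2 * δ / φ)) + e / 3 := by
        gcongr
    _ = expectedRegret U φ C m / m + ENNReal.ofReal (m ^ 2 * δ / φ) / m + e / 3 := by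
        simp only [div_eq_mul_inv]; ring
    _ ≤ e / 3 + e / 3 + e / 3 := by
        exact add_le_add (add_le_add (hM m (by omega)).2 hmδ) le_rfl
    _ = e := ENNReal.add_thirds e

end Regret

/-! ### Choice of the scale window and cutoff, and the conclusion -/

lemma exists_pos_measure_Icc {H : Measure ℝ} [IsProbabilityMeasure H] {κ : ℝ → ℝ}
    (hκ0 : ∀ᵐ r ∂H, 0 < κ r) :
    ∃ a b : ℝ, 0 < a ∧ a ≤ b ∧ 0 < H.real {r | a ≤ κ r ∧ κ r ≤ b} := by
  by_contra! h
  have hz : ∀ k : ℕ, H {r | 1 / ((k : ℝ) + 1) ≤ κ r ∧ κ r ≤ k + 1} = 0 := by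
    intro k
    have h1 : 1 / ((k : ℝ) + 1) ≤ 1 := by
      rw [div_le_one (by positivity)]; linarith [(Nat.cast_nonneg k : (0 : ℝ) ≤ k)]
    have h2 : (1 : ℝ) ≤ k + 1 := by linarith [(Nat.cast_nonneg k : (0 : ℝ) ≤ k)]
    have := le_antisymm (h (1 / ((k : ℝ) + 1)) (k + 1) (by positivity) (h1.trans h2))
      measureReal_nonneg
    rwa [measureReal_eq_zero_iff] at this
  have hU := measure_iUnion_null hz
  have : ∀ᵐ r ∂H, False := by
    filter_upwards [hκ0, measure_eq_zero_iff_ae_notMem.1 hU] with r hr hn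
    obtain ⟨k₁, hk₁⟩ := exists_nat_one_div_lt hr
    obtain ⟨k₂, hk₂⟩ := exists_nat_ge (κ r)
    refine hn (Set.mem_iUnion.2 ⟨max k₁ k₂, ?_, ?_⟩)
    · refine le_trans ?_ hk₁.le
      gcongr
      exact_mod_cast le_max_left k₁ k₂
    · refine hk₂.trans ?_
      have : (k₂ : ℝ) ≤ (max k₁ k₂ : ℕ) := by exact_mod_cast le_max_right k₁ k₂
      linarith
  rw [ae_iff] at this
  simp at this

/-- Absolute continuity of the integral: the integrand is integrable by the log-moment condition,
and `H {κ < ε}` tends to zero because `κ` is almost surely positive. -/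
lemma exists_small_scale_setLIntegral_le {H : Measure ℝ} [IsProbabilityMeasure H] {κ : ℝ → ℝ}
    (hκ : Measurable κ) (hκ0 : ∀ᵐ r ∂H, 0 < κ r)
    (hκlog : ∫⁻ r, ENNReal.ofReal (-Real.log (κ r)) ∂H < ∞) {a b : ℝ} (ha : 0 < a) {e : ℝ≥0∞}
    (he : 0 < e) :
    ∃ ε : ℝ, 0 < ε ∧ ε ≤ a ∧
      ∫⁻ r in {r | κ r < ε}, ENNReal.ofReal (Real.log b - Real.log (κ r)) ∂H ≤ e := by
  have hfin : ∫⁻ r, ENNReal.ofReal (Real.log b - Real.log (κ r)) ∂H ≠ ∞ := by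
    refine ne_top_of_le_ne_top (b := ∫⁻ r, (ENNReal.ofReal (Real.log b) +
      ENNReal.ofReal (-Real.log (κ r))) ∂H) ?_ (lintegral_mono fun r => ?_)
    · rw [lintegral_add_left measurable_const]
      simpa using hκlog.ne
    · rw [sub_eq_add_neg]; exact ENNReal.ofReal_add_le
  set s : ℕ → Set ℝ := fun k => {r | κ r < a / (k + 1)}
  have hs : Tendsto (fun k => H (s k)) atTop (𝓝 0) := by
    have h1 : H (⋂ k, s k) = 0 := by
      rw [measure_eq_zero_iff_ae_notMem]
      filter_upwards [hκ0] with r hr hmem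
      obtain ⟨k, hk⟩ := exists_nat_one_div_lt (div_pos hr ha)
      have h2 : κ r < a / (k + 1) := Set.mem_iInter.1 hmem k
      rw [lt_div_iff₀ ha] at hk
      have : a / ((k : ℝ) + 1) = 1 / ((k : ℝ) + 1) * a := by ring
      linarith
    rw [← h1]
    refine tendsto_measure_iInter_atTop
      (fun k => (measurableSet_lt hκ measurable_const).nullMeasurableSet) ?_
      ⟨0, measure_ne_top _ _⟩
    intro i j hij r hr
    refine lt_of_lt_of_le (show κ r < a / (j + 1) from hr) ?_
    have : (i : ℝ) ≤ j := by exact_mod_cast hij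
    gcongr
  obtain ⟨k, hk⟩ := ((ENNReal.tendsto_nhds_zero.1 (tendsto_setLIntegral_zero hfin hs)) e he).exists
  refine ⟨a / (k + 1), by positivity, ?_, hk⟩
  exact div_le_self ha.le (by linarith [(Nat.cast_nonneg k : (0 : ℝ) ≤ k)])

/-- Information consistency for a deterministic sequence of plugged-in kernels. -/
lemma tendsto_expectedKL_div [MeasurableSpace 𝒳] {U : Measure 𝒳} [IsProbabilityMeasure U]
    {H : Measure ℝ} [IsProbabilityMeasure H] {κ : ℝ → ℝ}
    (hκ : Measurable κ) (hκ0 : ∀ᵐ r ∂H, 0 < κ r)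
    (hκlog : ∫⁻ r, ENNReal.ofReal (-Real.log (κ r)) ∂H < ∞) {φ : ℝ} (hφ : 0 < φ) {τ₀ : 𝒳 → ℝ}
    {C : 𝒳 → 𝒳 → ℝ} {K : ℕ → 𝒳 → 𝒳 → ℝ}
    (hK : ∀ n, IsCovKernel (K n)) (hC : IsCovKernel C)
    (hKm : ∀ n, Measurable (Function.uncurry (K n))) (hCm : Measurable (Function.uncurry C))
    (hunif : ∀ δ > 0, ∀ᶠ n in atTop, ∀ x x', |K n x x' - C x x'| ≤ δ) {B : ℝ}
    (hτ : RKHSNormLE C τ₀ B)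
    (hreg : Tendsto (fun n : ℕ => expectedRegret U φ C n / n) atTop (𝓝 0))
    (m : (n : ℕ) → Fin n → ℝ) :
    Tendsto (fun n : ℕ => expectedKL U H κ φ τ₀ (K n) (m n) / n) atTop (𝓝 0) := by
  have hregK := tendsto_expectedRegret_div hK hC hKm hCm hφ hunif hreg
  rw [ENNReal.tendsto_nhds_zero] at hregK ⊢
  intro e he
  have he4 : 0 < e / 4 := ENNReal.div_pos he.ne' (by simp)
  obtain ⟨a, b, ha, hab, hη⟩ := exists_pos_measure_Icc hκ0
  obtain ⟨ε, hε, hεa, hW⟩ := exists_small_scale_setLIntegral_le hκ hκ0 hκlog (b := b) ha he4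
  set W := ∫⁻ r in {r | κ r < ε}, ENNReal.ofReal (Real.log b - Real.log (κ r)) ∂H
  set c := Real.log 2 - Real.log (H.real {r | a ≤ κ r ∧ κ r ≤ b})
  obtain ⟨ρ, hρ0, hρ⟩ := ENNReal.lt_iff_exists_nnreal_btwn.1 he4
  have hρ0' : (0 : ℝ) < ρ := by exact_mod_cast hρ0
  -- Chosen after `ε`, so that the part `B²δ/(φε)` of the signal term that grows with `n` is at most
  -- `ρ` per observation; the `+ 1` guards against `B = 0`.
  set δ : ℝ := ρ * φ * ε / (B ^ 2 + 1)
  have hδ : 0 < δ := by positivity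
  have hδB : B ^ 2 * δ / φ / ε ≤ ρ := by
    have : B ^ 2 * δ / φ / ε = ρ * (B ^ 2 / (B ^ 2 + 1)) := by simp only [δ]; field_simp
    rw [this]
    refine mul_le_of_le_one_right hρ0'.le ?_
    rw [div_le_one (by positivity)]; linarith
  set D : ℝ≥0∞ := ENNReal.ofReal (B ^ 2 / ε + c) + 1
  have hD : D ≠ ∞ := by simp [D]
  have hDn : Tendsto (fun n : ℕ => D / n) atTop (𝓝 0) := by
    have := ENNReal.Tendsto.const_div (a := D) ENNReal.tendsto_nat_nhds_top (Or.inr hD)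
    rwa [ENNReal.div_top] at this
  filter_upwards [hunif δ hδ, hregK _ he4, (ENNReal.tendsto_nhds_zero.1 hDn) _ he4,
    eventually_ge_atTop 1] with n h1 h2 h3 h4
  have hn0 : (n : ℝ≥0∞) ≠ 0 := by
    have : n ≠ 0 := by omega
    exact_mod_cast this
  have hconst : ENNReal.ofReal (B ^ 2 * (1 + n * δ / φ) / ε + c) + n * W + 1 ≤
      D + n * (e / 4) + n * (e / 4) := by
    have : B ^ 2 * (1 + n * δ / φ) / ε + c ≤ (B ^ 2 / ε + c) + n * ρ := by
      have e1 : B ^ 2 * (1 + n * δ / φ) / ε + c =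
          (B ^ 2 / ε + c) + n * (B ^ 2 * δ / φ / ε) := by field_simp; ring
      rw [e1]; gcongr
    calc _ ≤ ENNReal.ofReal (B ^ 2 / ε + c) + n * (ρ : ℝ≥0∞) + n * W + 1 := by
          gcongr
          refine (ENNReal.ofReal_le_ofReal this).trans (ENNReal.ofReal_add_le.trans ?_)
          rw [ENNReal.ofReal_mul (Nat.cast_nonneg _)]
          simp
      _ = D + n * (ρ : ℝ≥0∞) + n * W := by simp only [D]; ring
      _ ≤ _ := by gcongr
  calc expectedKL U H κ φ τ₀ (K n) (m n) / n
      ≤ (expectedRegret U φ (K n) n + (D + n * (e / 4) + n * (e / 4))) / n := by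
        gcongr
        calc expectedKL U H κ φ τ₀ (K n) (m n)
            ≤ ∫⁻ X : Fin n → 𝒳, (ENNReal.ofReal (Real.log (1 + φ⁻¹ • gram (K n) X).det) +
                (D + n * (e / 4) + n * (e / 4))) ∂(Measure.pi fun _ => U) :=
              lintegral_mono fun X => (klDensity_le hκ hκ0 hφ (hK n) hτ hδ.le h1 hε hεa hab hη
                (m n) X).trans (by gcongr)
          _ = _ := by
              rw [lintegral_add_right _ measurable_const]
              simp [expectedRegret]
    _ = expectedRegret U φ (K n) n / n + (D / n + n * (e / 4) / n + n * (e / 4) / n) := by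
        rw [ENNReal.add_div, ENNReal.add_div, ENNReal.add_div]
    _ ≤ e / 4 + (e / 4 + e / 4 + e / 4) := by
        have : n * (e / 4) / n = e / 4 := by
          rw [mul_comm, ENNReal.mul_div_cancel_right hn0 (ENNReal.natCast_ne_top n)]
        rw [this]
        gcongr
    _ = 4 * (e / 4) := by ring
    _ = e := ENNReal.mul_div_cancel (by simp) (by simp)

end HPFR

end

theorem theorem1
    {p : ℕ} (𝒳 : Set (EuclideanSpace ℝ (Fin p)))
    (U : Measure 𝒳) [IsProbabilityMeasure U]
    {Θ : Type*} [TopologicalSpace Θ]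
    (C : Θ → 𝒳 → 𝒳 → ℝ)
    (hCcov : ∀ θ, HPFR.IsCovKernel (C θ))
    (hCmeas : ∀ θ, Measurable (Function.uncurry (C θ)))
    (H : Measure ℝ) [IsProbabilityMeasure H] (hH : ∀ᵐ r ∂H, 0 < r)
    (κ : ℝ → ℝ) (hκmeas : Measurable κ) (hκpos : ∀ r, 0 < r → 0 < κ r)
    (hκlog : ∫⁻ r, ENNReal.ofReal (-Real.log (κ r)) ∂H < ∞)
    (φ : ℝ) (hφ : 0 < φ)
    (μ : ℝ → ℝ) (t : (n : ℕ) → Fin n → ℝ)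
    (τ₀ : 𝒳 → ℝ) (θ₀ : Θ)
    {Ω : Type*} [MeasurableSpace Ω] (P : Measure Ω) [IsProbabilityMeasure P]
    (θhat : ℕ → Ω → Θ)
    -- (C1)
    (hCcont : ∀ θ₁, TendstoUniformly (fun θ => Function.uncurry (C θ)) (Function.uncurry (C θ₁))
      (𝓝 θ₁))
    (hθhat : ∀ᵐ ω ∂P, Tendsto (fun n => θhat n ω) atTop (𝓝 θ₀))
    -- (C2)
    (hτ₀ : ∃ B : ℝ, HPFR.RKHSNormLE (C θ₀) τ₀ B)
    -- (C3)
    (hregret : Tendsto (fun n : ℕ => HPFR.expectedRegret U φ (C θ₀) n / n) atTop (𝓝 0)) :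
    ∀ᵐ ω ∂P, Tendsto
      (fun n : ℕ =>
        HPFR.expectedKL U H κ φ τ₀ (C (θhat n ω)) (fun i : Fin n => μ (t n i)) / n)
      atTop (𝓝 0) := by
  obtain ⟨B, hB⟩ := hτ₀
  have hκ0 : ∀ᵐ r ∂H, 0 < κ r := hH.mono hκpos
  filter_upwards [hθhat] with ω hω
  refine HPFR.tendsto_expectedKL_div hκmeas hκ0 hκlog hφ (fun n => hCcov _) (hCcov θ₀)
    (fun n => hCmeas _) (hCmeas θ₀) (fun δ hδ => ?_) hB hregret _
  filter_upwards [hω.eventually (Metric.tendstoUniformly_iff.1 (hCcont θ₀) δ hδ)] with n hn x x'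
  have := hn (x, x')
  rw [dist_comm, Real.dist_eq] at this
  exact this.le
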